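/- Let $R$ be a (not necessarily commutative) ring with unit; all modules are right modules. For a ring $S$, let $K_0(S)$ be the Grothendieck group of finitely generated projective $S$-modules, i.e. the free abelian group on their isomorphism classes modulo the relations $[P]+[P'']-[P']$ for all short exact sequences $0\to P\to P'\to P''\to 0$. A \emph{strict perfect complex} of $S$-modules is a bounded complex $C$ (indexed by $\mathbb{Z}$) of finitely generated projective $S$-modules; its class is $[C]=\sum_n(-1)^n[C_n]\in K_0(S)$. A \emph{(quasi-coherent) sheaf on $\mathbb{P}^1$} (over $R$) is a diagram $M^-\xrightarrow{\mu^-}M\xleftarrow{\mu^+}M^+$, where $M^-$, $M$, $M^+$ are modules over $R[x^{-1}]$, $R[x,x^{-1}]$, $R[x]$, respectively, $\mu^-$ is $R[x^{-1}]$-linear, $\mu^+$ is $R[x]$-linear, and both adjoint maps $M^-\otimes_{R[x^{-1}]}R[x,x^{-1}]\to M\leftarrow M^+\otimes_{R[x]}R[x,x^{-1}]$ are isomorphisms; morphisms are compatible triples of linear maps. A sheaf is a \emph{vector bundle} if $M^-$, $M$, $M^+$ are finitely generated projective over their respective rings, and a \emph{strict perfect complex of sheaves} is a bounded chain complex of vector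 bundles. Let $K_0(\mathbb{P}^1)$ be the Grothendieck group of vector bundles on $\mathbb{P}^1$, with respect to the short exact sequences of vector bundles (i.e. those that are exact in each of the three constituents). A complex $C$ of $R[x,x^{-1}]$-modules \emph{extends to $\mathbb{P}^1$ up to quasi-isomorphism} if there is a strict perfect complex of sheaves $\mathcal{V}=(V^-\to V\leftarrow V^+)$ on $\mathbb{P}^1$ such that its restriction $V$ is connected to $C$ by a chain of quasi-isomorphisms of complexes of $R[x,x^{-1}]$-modules. \textbf{Theorem.} Let $C$ be a strict perfect complex of $R[x,x^{-1}]$-modules. The following three statements are equivalent: (1) The complex $C$ extends to $\mathbb{P}^1$ up to quasi-isomorphism. (2) The class $[C]\in K_0(R[x,x^{-1}])$ lies in the image of the map $p^*\colon K_0(R)\to K_0(R[x,x^{-1}])$, $[M]\mapsto[M\otimes_R R[x,x^{-1}]]$. (3) The class $[C]\in K_0(R[x,x^{-1}])$ lies in the image of the restriction map $i^*\colon K_0(\mathbb{P}^1)\to K_0(R[x,x^{-1}])$, $[M^-\to M\leftarrow M^+]\mapsto[M]$. -/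

import Mathlib

open CategoryTheory CategoryTheory.Limits
open scoped TensorProduct

universe u v

noncomputable section

/-! ### Extension of scalars along a homomorphism of (not necessarily commutative) rings -/

section ExtensionOfScalars

variable {A B : Type u} [Ring A] [Ring B] (f : A →+* B)

/-- The relations `b f(a) ⊗ m = b ⊗ a m` which cut `B ⊗_A M` out of `B ⊗_ℤ M`. -/
def balancedRelations (M : ModuleCat.{u} A) : Submodule B (B ⊗[ℤ] M) :=
  Submodule.span B {t | ∃ (b : B) (a : A) (m : M), t = (b * f a) ⊗ₜ[ℤ] m - b ⊗ₜ[ℤ] (a • m)}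

/-- The left `B`-module `B ⊗_A M`, for a left `A`-module `M` and a ring homomorphism `A → B`. -/
def extObj (M : ModuleCat.{u} A) : ModuleCat.{u} B :=
  ModuleCat.of B ((B ⊗[ℤ] M) ⧸ balancedRelations f M)

/-- The element `b ⊗ m` of `B ⊗_A M`. -/
def extTmul (M : ModuleCat.{u} A) (b : B) (m : M) : extObj f M :=
  (balancedRelations f M).mkQ (b ⊗ₜ[ℤ] m)

theorem extTmul_balanced (M : ModuleCat.{u} A) (b : B) (a : A) (m : M) :
    extTmul f M (b * f a) m = extTmul f M b (a • m) :=
  (Submodule.Quotient.eq _).2 (Submodule.subset_span ⟨b, a, m, rfl⟩)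

theorem extTmul_smul (M : ModuleCat.{u} A) (c b : B) (m : M) :
    c • extTmul f M b m = extTmul f M (c * b) m := rfl

theorem extTmul_add (M : ModuleCat.{u} A) (b : B) (m m' : M) :
    extTmul f M b (m + m') = extTmul f M b m + extTmul f M b m' := by
  simp only [extTmul, TensorProduct.tmul_add]
  exact map_add _ _ _

theorem ext_span (M : ModuleCat.{u} A) (p : Submodule B (extObj f M))
    (h : ∀ m : M, extTmul f M 1 m ∈ p) : p = ⊤ := by
  refine Submodule.eq_top_iff'.2 fun x => ?_
  obtain ⟨t, rfl⟩ := (balancedRelations f M).mkQ_surjective x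
  induction t with
  | zero => exact (map_zero (balancedRelations f M).mkQ).symm ▸ p.zero_mem
  | tmul b m =>
    have := p.smul_mem b (h m)
    rwa [extTmul_smul, mul_one] at this
  | add s t hs ht => exact (map_add (balancedRelations f M).mkQ s t).symm ▸ p.add_mem hs ht

/-- The unit `M → B ⊗_A M`, `m ↦ 1 ⊗ m`. -/
def extUnit (M : ModuleCat.{u} A) : M ⟶ (ModuleCat.restrictScalars f).obj (extObj f M) :=
  ModuleCat.ofHom (Y := (ModuleCat.restrictScalars f).obj (extObj f M))
    { toFun := fun m => extTmul f M 1 m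
      map_add' := extTmul_add f M 1
      map_smul' := fun a m => by
        change extTmul f M 1 (a • m) = f a • extTmul f M 1 m
        rw [extTmul_smul, ← extTmul_balanced, mul_one, one_mul] }

/-- The `B`-linear map `B ⊗_A M → N`, `b ⊗ m ↦ b g(m)`, adjoint to an `A`-linear `g : M → N`. -/
def extLift (M : ModuleCat.{u} A) (N : ModuleCat.{u} B)
    (g : M ⟶ (ModuleCat.restrictScalars f).obj N) : extObj f M ⟶ N :=
  ModuleCat.ofHom <| (balancedRelations f M).liftQ
    (TensorProduct.AlgebraTensorModule.lift
      (LinearMap.toSpanSingleton B (M →ₗ[ℤ] N)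
        (show M →+ N from g.hom.toAddMonoidHom).toIntLinearMap))
    (by
      refine Submodule.span_le.2 ?_
      rintro _ ⟨b, a, m, rfl⟩
      have h : (show N from g.hom (a • m)) = f a • (show N from g.hom m) := g.hom.map_smul a m
      rw [SetLike.mem_coe, LinearMap.mem_ker, map_sub, sub_eq_zero]
      change (b * f a) • (show N from g.hom m) = b • (show N from g.hom (a • m))
      rw [h, mul_smul])

theorem extLift_tmul (M : ModuleCat.{u} A) (N : ModuleCat.{u} B)
    (g : M ⟶ (ModuleCat.restrictScalars f).obj N) (b : B) (m : M) :
    (extLift f M N g).hom (extTmul f M b m) = b • (show N from g.hom m) := rfl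

/-- The bijection `Hom_B(B ⊗_A M, N) ≃ Hom_A(M, N)`. -/
def extHomEquiv (M : ModuleCat.{u} A) (N : ModuleCat.{u} B) :
    (extObj f M ⟶ N) ≃ (M ⟶ (ModuleCat.restrictScalars f).obj N) where
  toFun h := extUnit f M ≫ (ModuleCat.restrictScalars f).map h
  invFun g := extLift f M N g
  left_inv h := by
    ext x
    have : LinearMap.eqLocus (extLift f M N (extUnit f M ≫
        (ModuleCat.restrictScalars f).map h)).hom h.hom = ⊤ :=
      ext_span f M _ fun m => by
        rw [LinearMap.mem_eqLocus, extLift_tmul, one_smul]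
        rfl
    exact LinearMap.mem_eqLocus.1 (this ▸ Submodule.mem_top)
  right_inv g := by
    ext m
    exact one_smul B (show N from g.hom m)

/-- Extension of scalars `M ↦ B ⊗_A M` as a functor. -/
def extScalars : ModuleCat.{u} A ⥤ ModuleCat.{u} B :=
  Adjunction.leftAdjointOfEquiv (G := ModuleCat.restrictScalars f) (extHomEquiv f)
    (fun _ _ _ _ _ => rfl)

/-- Extension of scalars is left adjoint to restriction of scalars. -/
def extScalarsAdj : extScalars f ⊣ ModuleCat.restrictScalars.{u} f :=
  Adjunction.adjunctionOfEquivLeft (G := ModuleCat.restrictScalars f) (extHomEquiv f)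
    (fun _ _ _ _ _ => rfl)

instance : (extScalars f).Additive := (extScalarsAdj f).left_adjoint_additive

end ExtensionOfScalars

/-! ### Grothendieck groups -/

section GrothendieckGroup

variable {𝒜 : Type*} [Category 𝒜] [HasZeroMorphisms 𝒜]
  {ℬ : Type*} [Category ℬ] [HasZeroMorphisms ℬ]

/-- Isomorphism classes of the objects of `𝒜` that satisfy `P`. -/
abbrev IsoClasses (P : ObjectProperty 𝒜) := Quotient (isIsomorphicSetoid P.FullSubcategory)

/-- The isomorphism class of an object that satisfies `P`. -/
def isoClass {P : ObjectProperty 𝒜} (X : 𝒜) (hX : P X) : IsoClasses P :=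
  Quotient.mk (isIsomorphicSetoid P.FullSubcategory) ⟨X, hX⟩

/-- The subgroup generated by the elements `[X₁] + [X₃] - [X₂]`, for the sequences
`X₁ ⟶ X₂ ⟶ X₃` of objects satisfying `P` which belong to the class `E`
(of "short exact sequences"). -/
def K0Relations (P : ObjectProperty 𝒜) (E : ShortComplex 𝒜 → Prop) :
    AddSubgroup (FreeAbelianGroup (IsoClasses P)) :=
  AddSubgroup.closure {t | ∃ (S : ShortComplex 𝒜) (_ : E S) (h₁ : P S.X₁) (h₂ : P S.X₂)
    (h₃ : P S.X₃), t = FreeAbelianGroup.of (isoClass S.X₁ h₁) +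
      FreeAbelianGroup.of (isoClass S.X₃ h₃) - FreeAbelianGroup.of (isoClass S.X₂ h₂)}

/-- The Grothendieck group of the objects satisfying `P`, with respect to the class `E` of
short exact sequences. -/
abbrev K0Group (P : ObjectProperty 𝒜) (E : ShortComplex 𝒜 → Prop) :=
  FreeAbelianGroup (IsoClasses P) ⧸ K0Relations P E

/-- The class `[X]` of an object. -/
def K0Group.cls {P : ObjectProperty 𝒜} {E : ShortComplex 𝒜 → Prop} (X : 𝒜) (hX : P X) :
    K0Group P E :=
  QuotientAddGroup.mk (FreeAbelianGroup.of (isoClass X hX))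

/-- The homomorphism `[X] ↦ [F X]` of Grothendieck groups induced by a functor `F` which
preserves the distinguished objects and the short exact sequences between them. -/
def K0Group.map {P : ObjectProperty 𝒜} {E : ShortComplex 𝒜 → Prop}
    {P' : ObjectProperty ℬ} {E' : ShortComplex ℬ → Prop}
    (F : 𝒜 ⥤ ℬ) [F.PreservesZeroMorphisms] (hP : ∀ X, P X → P' (F.obj X))
    (hE : ∀ S : ShortComplex 𝒜, P S.X₁ → P S.X₂ → P S.X₃ → E S → E' (S.map F)) :
    K0Group P E →+ K0Group P' E' :=
  QuotientAddGroup.map _ _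
    (FreeAbelianGroup.map (Quotient.map' (fun X => ⟨F.obj X.obj, hP _ X.property⟩)
      (fun X Y ⟨e⟩ => ⟨P'.isoMk (F.mapIso (P.ι.mapIso e))⟩)))
    (by
      refine (AddSubgroup.closure_le _).2 ?_
      rintro _ ⟨S, hS, h₁, h₂, h₃, rfl⟩
      refine AddSubgroup.subset_closure ⟨S.map F, hE S h₁ h₂ h₃ hS, hP _ h₁, hP _ h₂, hP _ h₃, ?_⟩
      simp only [map_sub, map_add, FreeAbelianGroup.map_of_apply]
      rfl)

theorem K0Group.map_cls {P : ObjectProperty 𝒜} {E : ShortComplex 𝒜 → Prop}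
    {P' : ObjectProperty ℬ} {E' : ShortComplex ℬ → Prop}
    (F : 𝒜 ⥤ ℬ) [F.PreservesZeroMorphisms] (hP : ∀ X, P X → P' (F.obj X))
    (hE : ∀ S : ShortComplex 𝒜, P S.X₁ → P S.X₂ → P S.X₃ → E S → E' (S.map F))
    (X : 𝒜) (hX : P X) :
    K0Group.map (E := E) (E' := E') F hP hE (K0Group.cls X hX) =
      K0Group.cls (F.obj X) (hP X hX) :=
  congrArg QuotientAddGroup.mk (FreeAbelianGroup.map_of_apply _)

/-- A chain complex is bounded if it vanishes outside a finite range of degrees. -/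
def IsBoundedComplex (C : ChainComplex 𝒜 ℤ) : Prop :=
  ∃ a b : ℤ, ∀ n : ℤ, n < a ∨ b < n → IsZero (C.X n)

/-- Two chain complexes are quasi-isomorphic if they are connected by a chain of
quasi-isomorphisms (in either direction). -/
def AreQuasiIso [CategoryWithHomology 𝒜] (C D : ChainComplex 𝒜 ℤ) : Prop :=
  Relation.EqvGen (fun X Y : ChainComplex 𝒜 ℤ => ∃ φ : X ⟶ Y, QuasiIso φ) C D

end GrothendieckGroup

/-! ### Right modules and `K₀` of a ring -/

section RightModules

/-- The category of right modules over the ring `S`. -/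
abbrev RMod (S : Type u) [Ring S] := ModuleCat.{u} Sᵐᵒᵖ

/-- Restriction of scalars of right modules. -/
abbrev rRes {A B : Type u} [Ring A] [Ring B] (f : A →+* B) : RMod B ⥤ RMod A :=
  ModuleCat.restrictScalars f.op

/-- Extension of scalars `M ↦ M ⊗_A B` of right modules. -/
abbrev rExt {A B : Type u} [Ring A] [Ring B] (f : A →+* B) : RMod A ⥤ RMod B :=
  extScalars f.op

/-- Finitely generated projective right modules. -/
def fgProj (S : Type u) [Ring S] : ObjectProperty (RMod S) :=
  fun M => Module.Finite Sᵐᵒᵖ M ∧ Module.Projective Sᵐᵒᵖ M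

/-- `K₀` of a ring: the Grothendieck group of finitely generated projective right modules. -/
abbrev K0 (S : Type u) [Ring S] := K0Group (fgProj S) (fun E => E.ShortExact)

/-- Strict perfect complexes: bounded complexes of finitely generated projective modules. -/
structure IsStrictPerfect {S : Type u} [Ring S] (C : ChainComplex (RMod S) ℤ) : Prop where
  bounded : IsBoundedComplex C
  fgProj : ∀ n, fgProj S (C.X n)

/-- The class `[C] = ∑ₙ (-1)ⁿ [Cₙ]` in `K₀(S)` of a strict perfect complex `C`
(only finitely many terms are non-zero, see `IsStrictPerfect.finite_support`). -/
def IsStrictPerfect.K0Class {S : Type u} [Ring S] {C : ChainComplex (RMod S) ℤ}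
    (hC : IsStrictPerfect C) : K0 S :=
  ∑ᶠ n : ℤ, (n.negOnePow : ℤ) • (K0Group.cls (C.X n) (hC.fgProj n) : K0 S)

theorem K0.cls_eq_zero {S : Type u} [Ring S] (M : RMod S) (hM : fgProj S M) (h : IsZero M) :
    (K0Group.cls M hM : K0 S) = 0 := by
  have hS : (ShortComplex.mk (𝟙 M) (𝟙 M) (h.eq_of_src _ _)).ShortExact :=
    { exact := ShortComplex.exact_of_isZero_X₂ _ h
      mono_f := inferInstanceAs (Mono (𝟙 M))
      epi_g := inferInstanceAs (Epi (𝟙 M)) }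
  refine (QuotientAddGroup.eq_zero_iff _).2
    (AddSubgroup.subset_closure ⟨_, hS, hM, hM, hM, ?_⟩)
  simp

theorem IsStrictPerfect.finite_support {S : Type u} [Ring S] {C : ChainComplex (RMod S) ℤ}
    (hC : IsStrictPerfect C) : (Function.support fun n : ℤ =>
      (n.negOnePow : ℤ) • (K0Group.cls (C.X n) (hC.fgProj n) : K0 S)).Finite := by
  obtain ⟨a, b, h⟩ := hC.bounded
  refine (Set.finite_Icc a b).subset fun n hn => ?_
  by_contra hn'
  refine hn ?_
  have : n < a ∨ b < n := by
    by_contra! hab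
    exact hn' ⟨hab.1, hab.2⟩
  simp only [K0.cls_eq_zero _ _ (h n this), smul_zero]

theorem fgProj_rExt {A B : Type u} [Ring A] [Ring B] (f : A →+* B) (M : RMod A)
    (hM : fgProj A M) : fgProj B ((rExt f).obj M) := by
  obtain ⟨h₁, h₂⟩ := hM
  constructor
  · obtain ⟨s, hs⟩ := h₁.fg_top
    have hfin : (((extTmul f.op M 1) '' (s : Set M)) : Set (extObj f.op M)).Finite :=
      s.finite_toSet.image _
    suffices h : (⊤ : Submodule Bᵐᵒᵖ (extObj f.op M)).FG from ⟨h⟩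
    refine Submodule.fg_def.2 ⟨_, hfin, ext_span f.op M _ fun m => ?_⟩
    have hm : m ∈ Submodule.span Aᵐᵒᵖ (s : Set M) := hs ▸ Submodule.mem_top
    induction hm using Submodule.span_induction with
    | mem x hx => exact Submodule.subset_span ⟨x, hx, rfl⟩
    | zero =>
      have : extTmul f.op M 1 0 = 0 := (extUnit f.op M).hom.map_zero
      exact this ▸ Submodule.zero_mem _
    | add x y _ _ hx hy => exact (extTmul_add f.op M 1 x y) ▸ Submodule.add_mem _ hx hy
    | smul a x _ hx =>
      have : extTmul f.op M 1 (a • x) = f.op a • extTmul f.op M 1 x :=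
        (extUnit f.op M).hom.map_smul a x
      exact this ▸ Submodule.smul_mem _ _ hx
  · have hp : Projective M := (IsProjective.iff_projective (R := Aᵐᵒᵖ) M).1 h₂
    exact (IsProjective.iff_projective (R := Bᵐᵒᵖ) ((rExt f).obj M)).2
      ((extScalarsAdj f.op).map_projective _ hp)

/-- The homomorphism `K₀(A) → K₀(B)`, `[M] ↦ [M ⊗_A B]`, induced by a ring homomorphism. -/
def K0.extend {A B : Type u} [Ring A] [Ring B] (f : A →+* B) : K0 A →+ K0 B :=
  K0Group.map (rExt f) (fgProj_rExt f) (fun S _ _ h₃ hS => by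
    have : Projective S.X₃ := (IsProjective.iff_projective (R := Aᵐᵒᵖ) S.X₃).1 h₃.2
    exact (hS.splittingOfProjective.map (rExt f)).shortExact)

end RightModules

/-! ### The projective line -/

section ProjectiveLine

variable (R : Type u) [Ring R]

/-- The inclusion `R[x] → R[x, x⁻¹]`. -/
def inclPlus : Polynomial R →+* LaurentPolynomial R := Polynomial.toLaurent

/-- The inclusion `R[x⁻¹] → R[x, x⁻¹]`; here `R[x⁻¹]` is the polynomial ring over `R`,
whose indeterminate is sent to `x⁻¹`. -/
def inclMinus : Polynomial R →+* LaurentPolynomial R :=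
  Polynomial.eval₂RingHom' LaurentPolynomial.C (LaurentPolynomial.T (-1))
    (fun a => (LaurentPolynomial.commute_T (-1) (LaurentPolynomial.C a)).symm)

/-- Quasi-coherent sheaves on the projective line over `R`: diagrams
`M⁻ ⟶ M ⟵ M⁺` of right modules over `R[x⁻¹]`, `R[x, x⁻¹]` and `R[x]`, whose adjoint maps
`M⁻ ⊗ R[x, x⁻¹] ⟶ M ⟵ M⁺ ⊗ R[x, x⁻¹]` are isomorphisms. -/
structure P1Sheaf where
  minus : RMod (Polynomial R)
  torus : RMod (LaurentPolynomial R)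
  plus : RMod (Polynomial R)
  muMinus : minus ⟶ (rRes (inclMinus R)).obj torus
  muPlus : plus ⟶ (rRes (inclPlus R)).obj torus
  isIso_minus : IsIso (extLift (inclMinus R).op minus torus muMinus)
  isIso_plus : IsIso (extLift (inclPlus R).op plus torus muPlus)

variable {R}

namespace P1Sheaf

/-- Morphisms of sheaves: triples of linear maps compatible with the structure maps. -/
@[ext]
structure Hom (M N : P1Sheaf R) where
  minus : M.minus ⟶ N.minus
  torus : M.torus ⟶ N.torus
  plus : M.plus ⟶ N.plus
  comm_minus : M.muMinus ≫ (rRes (inclMinus R)).map torus = minus ≫ N.muMinus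
  comm_plus : M.muPlus ≫ (rRes (inclPlus R)).map torus = plus ≫ N.muPlus

instance : Category (P1Sheaf R) where
  Hom M N := Hom M N
  id M := ⟨𝟙 _, 𝟙 _, 𝟙 _, by simp, by simp⟩
  comp φ ψ := ⟨φ.minus ≫ ψ.minus, φ.torus ≫ ψ.torus, φ.plus ≫ ψ.plus,
    by rw [Functor.map_comp, ← Category.assoc, φ.comm_minus, Category.assoc, ψ.comm_minus,
      Category.assoc],
    by rw [Functor.map_comp, ← Category.assoc, φ.comm_plus, Category.assoc, ψ.comm_plus,
      Category.assoc]⟩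

@[ext]
theorem hom_ext {M N : P1Sheaf R} {φ ψ : M ⟶ N} (h₁ : Hom.minus φ = Hom.minus ψ)
    (h₂ : Hom.torus φ = Hom.torus ψ) (h₃ : Hom.plus φ = Hom.plus ψ) : φ = ψ :=
  Hom.ext h₁ h₂ h₃

/-- Morphisms of sheaves are added componentwise. -/
instance (M N : P1Sheaf R) : Add (M ⟶ N) :=
  ⟨fun φ ψ => (⟨Hom.minus φ + Hom.minus ψ, Hom.torus φ + Hom.torus ψ, Hom.plus φ + Hom.plus ψ,
    by simp [Hom.comm_minus], by simp [Hom.comm_plus]⟩ : Hom M N)⟩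

instance (M N : P1Sheaf R) : Zero (M ⟶ N) := ⟨(⟨0, 0, 0, by simp, by simp⟩ : Hom M N)⟩

instance (M N : P1Sheaf R) : Neg (M ⟶ N) :=
  ⟨fun φ => (⟨-Hom.minus φ, -Hom.torus φ, -Hom.plus φ,
    by simp [Hom.comm_minus], by simp [Hom.comm_plus]⟩ : Hom M N)⟩

instance (M N : P1Sheaf R) : AddCommGroup (M ⟶ N) :=
  { AddGroup.ofLeftAxioms (G := M ⟶ N)
      (fun φ ψ χ => hom_ext (add_assoc (Hom.minus φ) (Hom.minus ψ) (Hom.minus χ))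
        (add_assoc (Hom.torus φ) (Hom.torus ψ) (Hom.torus χ))
        (add_assoc (Hom.plus φ) (Hom.plus ψ) (Hom.plus χ)))
      (fun φ => hom_ext (zero_add (Hom.minus φ)) (zero_add (Hom.torus φ)) (zero_add (Hom.plus φ)))
      (fun φ => hom_ext (neg_add_cancel (Hom.minus φ)) (neg_add_cancel (Hom.torus φ))
        (neg_add_cancel (Hom.plus φ))) with
    add_comm := fun φ ψ => hom_ext (add_comm (Hom.minus φ) (Hom.minus ψ))
      (add_comm (Hom.torus φ) (Hom.torus ψ)) (add_comm (Hom.plus φ) (Hom.plus ψ)) }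

instance : Preadditive (P1Sheaf R) where
  add_comp _ _ _ φ φ' ψ :=
    hom_ext (Preadditive.add_comp _ _ _ (Hom.minus φ) (Hom.minus φ') (Hom.minus ψ))
      (Preadditive.add_comp _ _ _ (Hom.torus φ) (Hom.torus φ') (Hom.torus ψ))
      (Preadditive.add_comp _ _ _ (Hom.plus φ) (Hom.plus φ') (Hom.plus ψ))
  comp_add _ _ _ φ ψ ψ' :=
    hom_ext (Preadditive.comp_add _ _ _ (Hom.minus φ) (Hom.minus ψ) (Hom.minus ψ'))
      (Preadditive.comp_add _ _ _ (Hom.torus φ) (Hom.torus ψ) (Hom.torus ψ'))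
      (Preadditive.comp_add _ _ _ (Hom.plus φ) (Hom.plus ψ) (Hom.plus ψ'))

/-- Restriction to the affine line `Spec R[x⁻¹]`. -/
def resMinus : P1Sheaf R ⥤ RMod (Polynomial R) where
  obj M := M.minus
  map φ := Hom.minus φ

/-- Restriction to the torus `T = Spec R[x, x⁻¹]`. -/
def resTorus : P1Sheaf R ⥤ RMod (LaurentPolynomial R) where
  obj M := M.torus
  map φ := Hom.torus φ

/-- Restriction to the affine line `Spec R[x]`. -/
def resPlus : P1Sheaf R ⥤ RMod (Polynomial R) where
  obj M := M.plus
  map φ := Hom.plus φ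

instance : (resMinus (R := R)).Additive := ⟨rfl⟩
instance : (resTorus (R := R)).Additive := ⟨rfl⟩
instance : (resPlus (R := R)).Additive := ⟨rfl⟩

/-- Vector bundles: all three constituent modules are finitely generated projective. -/
def isVectorBundle (R : Type u) [Ring R] : ObjectProperty (P1Sheaf R) :=
  fun M => fgProj _ M.minus ∧ fgProj _ M.torus ∧ fgProj _ M.plus

/-- Short exact sequences of sheaves (exactness is tested on the three constituents). -/
def IsShortExact (S : ShortComplex (P1Sheaf R)) : Prop :=
  (S.map resMinus).ShortExact ∧ (S.map resTorus).ShortExact ∧ (S.map resPlus).ShortExact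

/-- Strict perfect complexes of sheaves: bounded complexes of vector bundles. -/
structure IsStrictPerfect (V : ChainComplex (P1Sheaf R) ℤ) : Prop where
  bounded : IsBoundedComplex V
  isVectorBundle : ∀ n, isVectorBundle R (V.X n)

end P1Sheaf

/-- `K₀(ℙ¹)`: the Grothendieck group of vector bundles on the projective line over `R`. -/
abbrev K0P1 (R : Type u) [Ring R] := K0Group (P1Sheaf.isVectorBundle R) P1Sheaf.IsShortExact

/-- The restriction map `i^* : K₀(ℙ¹) → K₀(R[x, x⁻¹])`, `[M⁻ ⟶ M ⟵ M⁺] ↦ [M]`. -/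
def iStar (R : Type u) [Ring R] : K0P1 R →+ K0 (LaurentPolynomial R) :=
  K0Group.map P1Sheaf.resTorus (fun _ h => h.2.1) (fun _ _ _ _ h => h.2.1)

/-- The pullback map `p^* : K₀(R) → K₀(R[x, x⁻¹])`, `[M] ↦ [M ⊗_R R[x, x⁻¹]]`. -/
def pStar (R : Type u) [Ring R] : K0 R →+ K0 (LaurentPolynomial R) :=
  K0.extend LaurentPolynomial.C

/-- The complex `C` of `R[x, x⁻¹]`-modules extends to the projective line up to
quasi-isomorphism: there is a strict perfect complex of sheaves whose restriction to the torus
is quasi-isomorphic to `C`. -/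
def ExtendsToP1 (C : ChainComplex (RMod (LaurentPolynomial R)) ℤ) : Prop :=
  ∃ V : ChainComplex (P1Sheaf R) ℤ, P1Sheaf.IsStrictPerfect V ∧
    AreQuasiIso ((P1Sheaf.resTorus.mapHomologicalComplex (ComplexShape.down ℤ)).obj V) C

end ProjectiveLine

end

open scoped ZeroObject

noncomputable section

/-! ### Finitely generated projective modules. -/

section FinitelyGeneratedProjective

variable {S : Type u} [Ring S]

/-! Write B = R[x, x⁻¹]. The cycle proved is (1) ⇒ (3) ⇒ (2) ⇒ (1).

(1) ⇒ (3). Quasi-isomorphic strict perfect complexes have the same class (`AreQuasiIso.K0Class_eq`):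
K-projectivity replaces the zigzag by a single quasi-isomorphism, and its mapping cone is a bounded
acyclic complex of projectives, whose class telescopes to zero. So [C] is the alternating sum of the
classes of bundles restricted to the torus.

(3) ⇒ (2). Let a vector bundle have torus module M. The images of M⁺ and M⁻ are lattices P and N in
M, over R[x] and R[x⁻¹]. Twisting N by a power of x leaves M unchanged, so N may be assumed to
contain generators of P. Then P + x⁻¹N = M: the first cohomology of the bundle and of its twist by
-1 vanishes. Hence the modules of sections H = P ∩ N and H' = P ∩ x⁻¹N are finitely generated
projective over R, and there is a short exact sequence 0 → H' ⊗ B → H ⊗ B → M → 0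
(`LaurentRing.exists_resolution`), the restriction to the torus of the canonical resolution of the
bundle. Thus [M] is a difference of extended classes.

(2) ⇒ (1). Adding contractible two-term complexes, from the lowest degree upwards, makes every term
but the top one extended from R without changing the quasi-isomorphism type. The class of the top
term is then in the image of `pStar`, so this term becomes extended after adding an extended module
(`exists_isExtended_isExtended_biprod`), and one more contractible summand finishes the job. A
bounded complex of extended modules extends to the projective line: each term carries lattices
generated by constants, and since the finitely many differentials have bounded degree in x, suitable
twists of these lattices are respected (`extendsToP1_of_extendedBasis`). -/

theorem fgProj_of_retract {M N : RMod S} (i : M ⟶ N) (r : N ⟶ M) (h : i ≫ r = 𝟙 M)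
    (hN : fgProj S N) : fgProj S M := by
  obtain ⟨h₁, h₂⟩ := hN
  have h' : r.hom ∘ₗ i.hom = LinearMap.id := by
    rw [← ModuleCat.hom_comp, h, ModuleCat.hom_id]
  refine ⟨Module.Finite.of_surjective r.hom fun m => ⟨i.hom m, ?_⟩,
    Module.Projective.of_split i.hom r.hom h'⟩
  exact LinearMap.congr_fun h' m

theorem fgProj_of_iso {M N : RMod S} (e : M ≅ N) (hN : fgProj S N) : fgProj S M :=
  fgProj_of_retract e.hom e.inv e.hom_inv_id hN

theorem fgProj_biprod {M N : RMod S} (hM : fgProj S M) (hN : fgProj S N) :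
    fgProj S (M ⊞ N) := by
  refine fgProj_of_iso (ModuleCat.biprodIsoProd M N) ?_
  obtain ⟨_, _⟩ := hM
  obtain ⟨_, _⟩ := hN
  exact ⟨inferInstanceAs (Module.Finite Sᵐᵒᵖ (M × N)),
    inferInstanceAs (Module.Projective Sᵐᵒᵖ (M × N))⟩

theorem fgProj_of_isZero {M : RMod S} (h : IsZero M) : fgProj S M := by
  have := ModuleCat.subsingleton_of_isZero h
  exact ⟨inferInstance, inferInstance⟩

theorem fgProj.projective {M : RMod S} (hM : fgProj S M) : Projective M :=
  (IsProjective.iff_projective (R := Sᵐᵒᵖ) M).1 hM.2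

theorem fgProj_of_iso_biprod {M N P : RMod S} (e : M ⊞ N ≅ P) (hP : fgProj S P) :
    fgProj S M :=
  fgProj_of_retract (biprod.inl ≫ e.hom) (e.inv ≫ biprod.fst) (by simp) hP

end FinitelyGeneratedProjective

/-! ### Elements of `K₀` and stable isomorphism. -/

section K0Basics

theorem K0Group.cls_eq_of_iso {𝒜 : Type*} [Category 𝒜] [HasZeroMorphisms 𝒜]
    {P : ObjectProperty 𝒜} {E : ShortComplex 𝒜 → Prop} {X Y : 𝒜} (e : X ≅ Y)
    (hX : P X) (hY : P Y) :
    (K0Group.cls X hX : K0Group P E) = K0Group.cls Y hY := by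
  unfold K0Group.cls isoClass
  congr 2
  exact Quotient.sound ⟨P.isoMk e⟩

theorem K0Group.cls_add_cls {𝒜 : Type*} [Category 𝒜] [HasZeroMorphisms 𝒜]
    {P : ObjectProperty 𝒜} {E : ShortComplex 𝒜 → Prop} (T : ShortComplex 𝒜) (hT : E T)
    (h₁ : P T.X₁) (h₂ : P T.X₂) (h₃ : P T.X₃) :
    (K0Group.cls T.X₂ h₂ : K0Group P E) = K0Group.cls T.X₁ h₁ + K0Group.cls T.X₃ h₃ := by
  symm
  rw [← sub_eq_zero]
  exact (QuotientAddGroup.eq_zero_iff _).2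
    (AddSubgroup.subset_closure ⟨T, hT, h₁, h₂, h₃, rfl⟩)

/-- A property of `K₀` which holds for the classes of objects and is stable under differences
holds everywhere. -/
theorem K0Group.mem_of_cls_mem {𝒜 : Type*} [Category 𝒜] [HasZeroMorphisms 𝒜]
    {P : ObjectProperty 𝒜} {E : ShortComplex 𝒜 → Prop} (G : AddSubgroup (K0Group P E))
    (h : ∀ X hX, K0Group.cls X hX ∈ G) (z : K0Group P E) : z ∈ G := by
  obtain ⟨t, rfl⟩ := QuotientAddGroup.mk_surjective z
  induction t using FreeAbelianGroup.induction_on with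
  | zero => exact G.zero_mem
  | of x =>
    obtain ⟨X, rfl⟩ := Quotient.mk_surjective x
    exact h X.obj X.property
  | neg x hx => exact G.neg_mem hx
  | add x y hx hy => exact G.add_mem hx hy

variable {S : Type u} [Ring S]

theorem K0.cls_biprod {M N : RMod S} (hM : fgProj S M) (hN : fgProj S N) :
    (K0Group.cls (M ⊞ N) (fgProj_biprod hM hN) : K0 S) =
      K0Group.cls M hM + K0Group.cls N hN :=
  K0Group.cls_add_cls (ShortComplex.mk (biprod.inl : M ⟶ M ⊞ N) biprod.snd (by simp))
    (ShortComplex.Splitting.ofHasBinaryBiproduct M N).shortExact hM (fgProj_biprod hM hN) hN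

theorem K0.exists_cls_sub_cls (z : K0 S) :
    ∃ (P Q : RMod S) (hP : fgProj S P) (hQ : fgProj S Q),
      z = K0Group.cls P hP - K0Group.cls Q hQ := by
  let G : AddSubgroup (K0 S) :=
    { carrier := {z | ∃ (P Q : RMod S) (hP : fgProj S P) (hQ : fgProj S Q),
        z = K0Group.cls P hP - K0Group.cls Q hQ}
      zero_mem' := by
        have h0 : fgProj S (ModuleCat.of Sᵐᵒᵖ PUnit) := ⟨inferInstance, inferInstance⟩
        exact ⟨_, _, h0, h0, (sub_self _).symm⟩
      add_mem' := by
        rintro _ _ ⟨P, Q, hP, hQ, rfl⟩ ⟨P', Q', hP', hQ', rfl⟩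
        refine ⟨P ⊞ P', Q ⊞ Q', fgProj_biprod hP hP', fgProj_biprod hQ hQ', ?_⟩
        rw [K0.cls_biprod hP hP', K0.cls_biprod hQ hQ']
        abel
      neg_mem' := by
        rintro _ ⟨P, Q, hP, hQ, rfl⟩
        exact ⟨Q, P, hQ, hP, neg_sub _ _⟩ }
  have h0 := isZero_zero (RMod S)
  refine K0Group.mem_of_cls_mem G (fun X hX => ⟨X, 0, hX, fgProj_of_isZero h0, ?_⟩) z
  rw [K0.cls_eq_zero _ _ h0, sub_zero]

/-- Isomorphism classes of finitely generated projective modules are added by `⊞`. -/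
instance isoClassesAdd : Add (IsoClasses (fgProj S)) where
  add := Quotient.map₂ (fun X Y => ⟨X.obj ⊞ Y.obj, fgProj_biprod X.property Y.property⟩)
    (fun _ _ ⟨e⟩ _ _ ⟨e'⟩ => ⟨(fgProj S).isoMk
      (biprod.mapIso ((fgProj S).ι.mapIso e) ((fgProj S).ι.mapIso e'))⟩)

instance isoClassesZero : Zero (IsoClasses (fgProj S)) where
  zero := isoClass 0 (fgProj_of_isZero (isZero_zero _))

instance isoClassesAddCommMonoid : AddCommMonoid (IsoClasses (fgProj S)) where
  add_assoc := by
    rintro ⟨X⟩ ⟨Y⟩ ⟨Z⟩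
    exact Quotient.sound ⟨(fgProj S).isoMk (biprod.associator _ _ _)⟩
  zero_add := by
    rintro ⟨X⟩
    exact Quotient.sound ⟨(fgProj S).isoMk (isoZeroBiprod (isZero_zero _)).symm⟩
  add_zero := by
    rintro ⟨X⟩
    exact Quotient.sound ⟨(fgProj S).isoMk (isoBiprodZero (isZero_zero _)).symm⟩
  add_comm := by
    rintro ⟨X⟩ ⟨Y⟩
    exact Quotient.sound ⟨(fgProj S).isoMk (biprod.braiding _ _)⟩
  nsmul := nsmulRec

/-- The comparison of `K₀` with the group completion of the monoid of isomorphism classes. -/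
def K0.toGroupCompletion : K0 S →+ Algebra.GrothendieckAddGroup (IsoClasses (fgProj S)) :=
  QuotientAddGroup.lift _ (FreeAbelianGroup.lift Algebra.GrothendieckAddGroup.of) (by
    refine (AddSubgroup.closure_le _).2 ?_
    rintro _ ⟨T, hT, h₁, h₂, h₃, rfl⟩
    -- Short exact sequences of projectives split, so the defining relations already hold in the
    -- group completion of the monoid under `⊞`.
    have := h₃.projective
    have e : T.X₁ ⊞ T.X₃ ≅ T.X₂ := hT.splittingOfProjective.isoBinaryBiproduct.symm
    have h : isoClass T.X₁ h₁ + isoClass T.X₃ h₃ = isoClass T.X₂ h₂ :=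
      Quotient.sound ⟨(fgProj S).isoMk e⟩
    simp [AddMonoidHom.mem_ker, ← h])

/-- Modules with the same class in `K₀` are stably isomorphic. -/
theorem K0.exists_stable_iso {M N : RMod S} (hM : fgProj S M) (hN : fgProj S N)
    (h : (K0Group.cls M hM : K0 S) = K0Group.cls N hN) :
    ∃ Z : RMod S, fgProj S Z ∧ Nonempty (Z ⊞ M ≅ Z ⊞ N) := by
  have h' := congrArg K0.toGroupCompletion h
  have key : ∀ (X : RMod S) (hX : fgProj S X), K0.toGroupCompletion (K0Group.cls X hX) =
      AddLocalization.mk (isoClass X hX) 0 := fun X hX => by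
    change FreeAbelianGroup.lift _ (FreeAbelianGroup.of _) = _
    rw [FreeAbelianGroup.lift_apply_of]
    rfl
  rw [key, key, AddLocalization.mk_eq_mk_iff, AddLocalization.r_iff_exists] at h'
  obtain ⟨⟨c, _⟩, hc⟩ := h'
  obtain ⟨⟨Z, hZ⟩, rfl⟩ := Quotient.mk_surjective c
  simp only [AddSubmonoid.coe_zero, zero_add] at hc
  obtain ⟨e⟩ := Quotient.exact hc
  exact ⟨Z, hZ, ⟨(fgProj S).ι.mapIso e⟩⟩

end K0Basics

/-! ### Lifting quasi-isomorphisms in the derived category. -/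

section ProjectiveLifting

open HomologicalComplex DerivedCategory

variable {𝒜 : Type u} [Category.{v} 𝒜] [Abelian 𝒜]

attribute [local instance] HasDerivedCategory.standard in
/-- Quasi-isomorphisms out of a K-projective complex lift along quasi-isomorphisms. -/
theorem CochainComplex.IsKProjective.exists_quasiIso_lift {P X Y : CochainComplex 𝒜 ℤ}
    [P.IsKProjective] (f : X ⟶ Y) [QuasiIso f] (g : P ⟶ Y) [QuasiIso g] :
    ∃ g' : P ⟶ X, QuasiIso g' := by
  -- The fraction `g` followed by `f⁻¹` exists in the derived category; K-projectivity of `P` makes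
  -- it a homotopy class of maps, represented by a chain map.
  obtain ⟨l, hl⟩ := (Qh_map_bijective P ((HomotopyCategory.quotient 𝒜 (.up ℤ)).obj X)).surjective
    ((quotientCompQhIso 𝒜).hom.app P ≫ Q.map g ≫ inv (Q.map f) ≫
      (quotientCompQhIso 𝒜).inv.app X)
  obtain ⟨g', rfl⟩ := (HomotopyCategory.quotient 𝒜 (.up ℤ)).map_surjective l
  have : IsIso (Qh.map ((HomotopyCategory.quotient 𝒜 (.up ℤ)).map g')) := by
    rw [hl]
    infer_instance
  refine ⟨g', ?_⟩
  rw [← DerivedCategory.isIso_Q_map_iff_quasiIso]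
  exact ((MorphismProperty.isomorphisms _).arrow_mk_iso_iff
    (Arrow.isoOfNatIso (quotientCompQhIso 𝒜) (Arrow.mk g'))).1 this

end ProjectiveLifting

/-! ### From zigzags to a single quasi-isomorphism of cochain complexes. -/

section Restriction

open ComplexShape HomologicalComplex

variable {𝒜 : Type u} [Category.{v} 𝒜] [Abelian 𝒜]

/-- The cochain complex obtained from a chain complex by the reindexing `n ↦ -n`. -/
abbrev ChainComplex.toCochain (C : ChainComplex 𝒜 ℤ) : CochainComplex 𝒜 ℤ :=
  C.restriction embeddingUpIntDownInt

theorem ChainComplex.quasiIso_toCochain {C D : ChainComplex 𝒜 ℤ} (f : C ⟶ D) [QuasiIso f] :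
    QuasiIso (restrictionMap f embeddingUpIntDownInt) where
  quasiIsoAt n := by
    have h : QuasiIsoAt f (-n) := inferInstance
    rw [quasiIsoAt_iff' f (-(n - 1)) (-n) (-(n + 1)) (by simp; ring) (by simp; ring)] at h
    rw [quasiIsoAt_iff' _ (n - 1) n (n + 1) (by simp) (by simp)]
    exact h

theorem CochainComplex.isKProjective_of_bounded (K : CochainComplex 𝒜 ℤ) (b : ℤ)
    (hb : ∀ n, b < n → IsZero (K.X n)) (hK : ∀ n, Projective (K.X n)) : K.IsKProjective := by
  have : K.IsStrictlyLE b := by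
    rw [CochainComplex.isStrictlyLE_iff]
    exact fun i hi => hb i hi
  exact CochainComplex.isKProjective_of_projective K b

/-- A complex which is bounded and projective has an honest quasi-isomorphism to each complex
to which it is connected by a chain of quasi-isomorphisms. -/
theorem AreQuasiIso.exists_quasiIso {C D : ChainComplex 𝒜 ℤ} (h : AreQuasiIso C D)
    (hC : C.toCochain.IsKProjective) :
    ∃ f : C.toCochain ⟶ D.toCochain, QuasiIso f := by
  -- Receiving a quasi-isomorphism from `C` passes along each arrow of the zigzag both ways:
  -- forwards by composition, backwards by K-projective lifting. Stating this as an equivalence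
  -- makes the `symm` case trivial.
  have key : (∃ f : C.toCochain ⟶ C.toCochain, QuasiIso f) ↔
      ∃ f : C.toCochain ⟶ D.toCochain, QuasiIso f := by
    have : ∀ {X Y : ChainComplex 𝒜 ℤ},
        Relation.EqvGen (fun X Y : ChainComplex 𝒜 ℤ => ∃ φ : X ⟶ Y, QuasiIso φ) X Y →
        ((∃ f : C.toCochain ⟶ X.toCochain, QuasiIso f) ↔
          ∃ f : C.toCochain ⟶ Y.toCochain, QuasiIso f) := by
      intro X Y h
      induction h with
      | rel X Y h =>
        obtain ⟨φ, hφ⟩ := h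
        have := ChainComplex.quasiIso_toCochain φ
        refine ⟨fun ⟨f, hf⟩ => ⟨f ≫ restrictionMap φ embeddingUpIntDownInt, inferInstance⟩, ?_⟩
        rintro ⟨g, hg⟩
        exact CochainComplex.IsKProjective.exists_quasiIso_lift
          (restrictionMap φ embeddingUpIntDownInt) g
      | refl X => rfl
      | symm X Y _ ih => exact ih.symm
      | trans X Y Z _ _ ih ih' => exact ih.trans ih'
    exact this h
  exact key.1 ⟨𝟙 _, inferInstance⟩

end Restriction

/-! ### The Euler characteristic in `K₀` and its invariance. -/

section EulerCharacteristic

variable {S : Type u} [Ring S]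

/-- The class `∑ₙ (-1)ⁿ [Kⁿ]` of a bounded cochain complex of finitely generated projectives. -/
def CochainComplex.K0Class (K : CochainComplex (RMod S) ℤ) (hK : ∀ n, fgProj S (K.X n)) : K0 S :=
  ∑ᶠ n : ℤ, (n.negOnePow : ℤ) • (K0Group.cls (K.X n) (hK n) : K0 S)

theorem IsStrictPerfect.K0Class_eq_toCochain {C : ChainComplex (RMod S) ℤ}
    (hC : IsStrictPerfect C) :
    hC.K0Class = C.toCochain.K0Class (fun n => hC.fgProj (-n)) := by
  unfold IsStrictPerfect.K0Class CochainComplex.K0Class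
  rw [← finsum_comp_equiv (Equiv.neg ℤ)]
  refine finsum_congr fun n => ?_
  simp only [Equiv.neg_apply, Int.negOnePow_neg]
  rfl

theorem hasFiniteSupport_of_isZero {X : ℤ → RMod S} (hX : ∀ n, fgProj S (X n)) {a b : ℤ}
    (h : ∀ n, n < a ∨ b < n → IsZero (X n)) (e : ℤ → ℤ) :
    (Function.support fun n : ℤ => e n • (K0Group.cls (X n) (hX n) : K0 S)).Finite := by
  refine (Set.finite_Icc a b).subset fun n hn => ?_
  by_contra hn'
  refine hn ?_
  have : n < a ∨ b < n := by
    by_contra! hab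
    exact hn' ⟨hab.1, hab.2⟩
  simp only [K0.cls_eq_zero _ _ (h n this), smul_zero]

/-- The cocycles of a cochain complex, as a submodule. -/
abbrev CochainComplex.cocycles (K : CochainComplex (RMod S) ℤ) (n : ℤ) : RMod S :=
  ModuleCat.of Sᵐᵒᵖ (LinearMap.ker (K.d n (n + 1)).hom)

/-- The sequence `Zⁿ ⟶ Kⁿ ⟶ Zⁿ⁺¹`. -/
def CochainComplex.cocyclesSequence (K : CochainComplex (RMod S) ℤ) (n : ℤ) :
    ShortComplex (RMod S) :=
  ShortComplex.mk (X₁ := K.cocycles n) (X₂ := K.X n) (X₃ := K.cocycles (n + 1))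
    (ModuleCat.ofHom (LinearMap.ker (K.d n (n + 1)).hom).subtype)
    (ModuleCat.ofHom ((K.d n (n + 1)).hom.codRestrict _ fun x => by
      rw [LinearMap.mem_ker]
      exact congr($(K.d_comp_d n (n + 1) (n + 1 + 1)) x)))
    (by
      ext x
      exact x.2)

/-- Only surjectivity on the right uses acyclicity: every cocycle in degree n + 1 is a coboundary.
-/
theorem CochainComplex.cocyclesSequence_shortExact (K : CochainComplex (RMod S) ℤ)
    (hK : K.Acyclic) (n : ℤ) : (K.cocyclesSequence n).ShortExact where
  exact := by
    rw [ShortComplex.moduleCat_exact_iff]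
    intro x hx
    exact ⟨⟨x, congrArg Subtype.val hx⟩, rfl⟩
  mono_f := (ModuleCat.mono_iff_injective _).2 Subtype.val_injective
  epi_g := by
    refine (ModuleCat.epi_iff_surjective _).2 ?_
    rintro ⟨y, hy⟩
    have h := (K.exactAt_iff' n (n + 1) (n + 1 + 1) (by simp) (by simp)).1 (hK (n + 1))
    rw [ShortComplex.moduleCat_exact_iff] at h
    obtain ⟨x, hx⟩ := h y hy
    exact ⟨x, Subtype.ext hx⟩

/-- Descending induction from above `b`, where everything vanishes: once Zⁿ⁺¹ is projective, Zⁿ → Kⁿ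
→ Zⁿ⁺¹ splits and Zⁿ is a retract of Kⁿ. -/
theorem CochainComplex.fgProj_cocycles (K : CochainComplex (RMod S) ℤ) (hK : K.Acyclic)
    (hP : ∀ n, fgProj S (K.X n)) {b : ℤ} (hb : ∀ n, b < n → IsZero (K.X n)) (n : ℤ) :
    fgProj S (K.cocycles n) := by
  have key : ∀ (m : ℕ) (n : ℤ), b < n + m → fgProj S (K.cocycles n) := by
    intro m
    induction m with
    | zero =>
      intro n hn
      have := ModuleCat.subsingleton_of_isZero (hb n (by simpa using hn))
      have : Subsingleton (K.cocycles n) := Subtype.val_injective.subsingleton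
      exact ⟨inferInstance, inferInstance⟩
    | succ m ih =>
      intro n hn
      have h := K.cocyclesSequence_shortExact hK n
      have : Projective (K.cocyclesSequence n).X₃ :=
        (ih (n + 1) (by push_cast at hn; linarith)).projective
      have s := h.splittingOfProjective
      exact fgProj_of_retract _ _ s.f_r (hP n)
  exact key (b + 1 - n).toNat n (by have := Int.self_le_toNat (b + 1 - n); linarith)

/-- Since [Kⁿ] = [Zⁿ] + [Zⁿ⁺¹], the alternating sum telescopes. -/
theorem CochainComplex.K0Class_eq_zero (K : CochainComplex (RMod S) ℤ) (hK : K.Acyclic)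
    (hP : ∀ n, fgProj S (K.X n)) {a b : ℤ} (hab : ∀ n, n < a ∨ b < n → IsZero (K.X n)) :
    K.K0Class hP = 0 := by
  have hZ := K.fgProj_cocycles hK hP (fun n hn => hab n (Or.inr hn))
  have hZ' : ∀ n, n < a ∨ b < n → IsZero (K.cocycles n) := fun n hn => by
    have := ModuleCat.subsingleton_of_isZero (hab n hn)
    have : Subsingleton (K.cocycles n) := Subtype.val_injective.subsingleton
    exact ModuleCat.isZero_of_subsingleton _
  let z : ℤ → K0 S := fun n => (n.negOnePow : ℤ) • K0Group.cls (K.cocycles n) (hZ n)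
  have hz : (Function.support z).Finite := hasFiniteSupport_of_isZero hZ hZ' _
  have hz' : (Function.support fun n => z (n + 1)).Finite := by
    refine (hz.preimage (f := fun n : ℤ => n + 1) (add_left_injective 1).injOn).subset ?_
    exact fun n hn => hn
  have h : ∀ n, (n.negOnePow : ℤ) • (K0Group.cls (K.X n) (hP n) : K0 S) = z n - z (n + 1) := by
    intro n
    have := K0Group.cls_add_cls (P := fgProj S) (E := fun E => E.ShortExact)
      (K.cocyclesSequence n) (K.cocyclesSequence_shortExact hK n) (hZ n) (hP n) (hZ (n + 1))
    change (n.negOnePow : ℤ) • (K0Group.cls (K.cocyclesSequence n).X₂ (hP n) : K0 S) = _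
    rw [this, smul_add]
    simp only [z, Int.negOnePow_succ, Units.val_neg, neg_smul, sub_neg_eq_add]
    rfl
  rw [CochainComplex.K0Class, finsum_congr h, finsum_sub_distrib hz hz',
    show ∑ᶠ n, z (n + 1) = ∑ᶠ n, z n from finsum_comp_equiv (Equiv.addRight (1 : ℤ)), sub_self]

open CochainComplex HomologicalComplex in
theorem CochainComplex.acyclic_mappingCone {K L : CochainComplex (RMod S) ℤ} (φ : K ⟶ L)
    [hφ : QuasiIso φ] : (mappingCone φ).Acyclic := by
  rw [← HomotopyCategory.quotient_obj_mem_subcategoryAcyclic_iff_acyclic]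
  have h := HomotopyCategory.mappingCone_triangleh_distinguished φ
  refine ((HomotopyCategory.subcategoryAcyclic (RMod S)).trW_iff_of_distinguished _ h).1 ?_
  rw [← HomotopyCategory.quasiIso_eq_trW_subcategoryAcyclic]
  exact (HomotopyCategory.quotient_map_mem_quasiIso_iff φ).2 hφ

open CochainComplex HomologicalComplex in
-- The cone is acyclic and has Kⁿ⁺¹ ⊞ Lⁿ in degree n, so its vanishing class is [L] - [K].
theorem CochainComplex.K0Class_eq_of_quasiIso {K L : CochainComplex (RMod S) ℤ} (φ : K ⟶ L)
    [hφ : QuasiIso φ] (hK : ∀ n, fgProj S (K.X n)) (hL : ∀ n, fgProj S (L.X n)) {a b : ℤ}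
    (hKab : ∀ n, n < a ∨ b < n → IsZero (K.X n)) (hLab : ∀ n, n < a ∨ b < n → IsZero (L.X n)) :
    K.K0Class hK = L.K0Class hL := by
  let e : ∀ n, (mappingCone φ).X n ≅ K.X (n + 1) ⊞ L.X n := fun n =>
    homotopyCofiber.XIsoBiprod φ n (n + 1) rfl
  have hP : ∀ n, fgProj S ((mappingCone φ).X n) := fun n =>
    fgProj_of_iso (e n) (fgProj_biprod (hK _) (hL _))
  have h0 : (mappingCone φ).K0Class hP = 0 := by
    -- The lower bound drops to a - 1 because of the shift of `K` in the cone.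
    refine K0Class_eq_zero _ (acyclic_mappingCone φ) hP (a := a - 1) (b := b) fun n hn => ?_
    rw [mappingCone.isZero_X_iff]
    exact ⟨hKab _ (by omega), hLab _ (by omega)⟩
  let k : ℤ → K0 S := fun n => (n.negOnePow : ℤ) • K0Group.cls (K.X n) (hK n)
  let l : ℤ → K0 S := fun n => (n.negOnePow : ℤ) • K0Group.cls (L.X n) (hL n)
  have hk : (Function.support k).Finite := hasFiniteSupport_of_isZero hK hKab _
  have hl : (Function.support l).Finite := hasFiniteSupport_of_isZero hL hLab _
  have hk' : (Function.support fun n => k (n + 1)).Finite := by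
    refine (hk.preimage (f := fun n : ℤ => n + 1) (add_left_injective 1).injOn).subset ?_
    exact fun n hn => hn
  have h : ∀ n, (n.negOnePow : ℤ) • (K0Group.cls ((mappingCone φ).X n) (hP n) : K0 S) =
      l n - k (n + 1) := by
    intro n
    rw [K0Group.cls_eq_of_iso (e n) (hP n) (fgProj_biprod (hK _) (hL _)),
      K0.cls_biprod (hK _) (hL _), smul_add]
    simp only [k, l, Int.negOnePow_succ, Units.val_neg, neg_smul, sub_neg_eq_add]
    rw [add_comm]
  rw [CochainComplex.K0Class, finsum_congr h, finsum_sub_distrib hl hk',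
    show ∑ᶠ n, k (n + 1) = ∑ᶠ n, k n from finsum_comp_equiv (Equiv.addRight (1 : ℤ)),
    sub_eq_zero] at h0
  exact h0.symm

/-- The class of a strict perfect complex is invariant under chains of quasi-isomorphisms. -/
theorem AreQuasiIso.K0Class_eq {C D : ChainComplex (RMod S) ℤ} (hC : IsStrictPerfect C)
    (hD : IsStrictPerfect D) (h : AreQuasiIso C D) : hC.K0Class = hD.K0Class := by
  rw [hC.K0Class_eq_toCochain, hD.K0Class_eq_toCochain]
  obtain ⟨a, b, hab⟩ := hC.bounded
  obtain ⟨a', b', hab'⟩ := hD.bounded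
  have h₁ : ∀ n, n < min (-b) (-b') ∨ max (-a) (-a') < n → IsZero (C.toCochain.X n) :=
    fun n hn => hab (-n) (by omega)
  have h₂ : ∀ n, n < min (-b) (-b') ∨ max (-a) (-a') < n → IsZero (D.toCochain.X n) :=
    fun n hn => hab' (-n) (by omega)
  obtain ⟨f, hf⟩ := h.exists_quasiIso (CochainComplex.isKProjective_of_bounded _ _
    (fun n hn => h₁ n (Or.inr hn)) (fun n => (hC.fgProj (-n)).projective))
  exact CochainComplex.K0Class_eq_of_quasiIso f _ _ h₁ h₂

end EulerCharacteristic

/-! ### Laurent polynomial rings and lattices -/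

/-- A presentation of `B` as the Laurent polynomial ring `A[t, t⁻¹]` in a central unit `t`. -/
structure LaurentRing (A B : Type u) [Ring A] [Ring B] where
  c : A →+* B
  t : Bˣ
  t_comm : ∀ b, (t : B) * b = b * t
  coeff : B →+ (ℤ →₀ A)
  coeff_one : coeff 1 = Finsupp.single 0 1
  coeff_c_mul : ∀ a b n, coeff (c a * b) n = a * coeff b n
  coeff_t_mul : ∀ b n, coeff (t * b) n = coeff b (n - 1)
  sum_coeff : ∀ b, ((coeff b).sum fun n a => c a * ((t ^ n : Bˣ) : B)) = b

namespace LaurentRing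

variable {A B : Type u} [Ring A] [Ring B] (D : LaurentRing A B)

theorem t_inv_comm (b : B) : ((D.t⁻¹ : Bˣ) : B) * b = b * ((D.t⁻¹ : Bˣ) : B) := by
  rw [Units.inv_mul_eq_iff_eq_mul, ← mul_assoc, D.t_comm, mul_assoc, Units.mul_inv, mul_one]

theorem coeff_t_inv_mul (b : B) (n : ℤ) :
    D.coeff (((D.t⁻¹ : Bˣ) : B) * b) n = D.coeff b (n + 1) := by
  have := D.coeff_t_mul (((D.t⁻¹ : Bˣ) : B) * b) (n + 1)
  rw [Units.mul_inv_cancel_left, add_sub_cancel_right] at this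
  exact this.symm

/-- The same ring, with `t` and `t⁻¹` exchanged. -/
def symm : LaurentRing A B where
  c := D.c
  t := D.t⁻¹
  t_comm := D.t_inv_comm
  coeff := (Finsupp.mapDomain.addMonoidHom (Equiv.neg ℤ)).comp D.coeff
  coeff_one := by simp [D.coeff_one, Finsupp.mapDomain_single]
  coeff_c_mul a b n := by
    change (D.coeff (D.c a * b)).mapDomain (Equiv.neg ℤ) n =
      a * (D.coeff b).mapDomain (Equiv.neg ℤ) n
    rw [Finsupp.mapDomain_equiv_apply, Finsupp.mapDomain_equiv_apply, D.coeff_c_mul]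
  coeff_t_mul b n := by
    change (D.coeff (((D.t⁻¹ : Bˣ) : B) * b)).mapDomain (Equiv.neg ℤ) n =
      (D.coeff b).mapDomain (Equiv.neg ℤ) (n - 1)
    rw [Finsupp.mapDomain_equiv_apply, Finsupp.mapDomain_equiv_apply, coeff_t_inv_mul]
    congr 1
    simp only [Equiv.neg_symm, Equiv.neg_apply]
    ring
  sum_coeff b := by
    rw [AddMonoidHom.comp_apply, Finsupp.mapDomain.addMonoidHom_apply,
      Finsupp.sum_mapDomain_index (by simp) (by simp [add_mul])]
    simpa using D.sum_coeff b

theorem symm_coeff (b : B) (n : ℤ) : D.symm.coeff b n = D.coeff b (-n) :=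
  Finsupp.mapDomain_equiv_apply _ _

theorem t_zpow_comm (k : ℤ) (b : B) : ((D.t ^ k : Bˣ) : B) * b = b * ((D.t ^ k : Bˣ) : B) := by
  have h : ∀ j : ℕ, ((D.t ^ j : Bˣ) : B) * b = b * ((D.t ^ j : Bˣ) : B) := fun j => by
    rw [Units.val_pow_eq_pow_val]
    exact (show Commute (D.t : B) b from D.t_comm b).pow_left j
  have h' : ∀ j : ℕ, (((D.t⁻¹) ^ j : Bˣ) : B) * b = b * (((D.t⁻¹) ^ j : Bˣ) : B) := fun j => by
    rw [Units.val_pow_eq_pow_val]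
    exact (show Commute ((D.t⁻¹ : Bˣ) : B) b from D.t_inv_comm b).pow_left j
  obtain ⟨j, rfl | rfl⟩ := k.eq_nat_or_neg
  · simpa using h j
  · simpa using h' j

theorem coeff_t_zpow_mul (k : ℤ) (b : B) (n : ℤ) :
    D.coeff (((D.t ^ k : Bˣ) : B) * b) n = D.coeff b (n - k) := by
  induction k generalizing n with
  | zero => simp
  | succ k ih =>
    rw [add_comm, zpow_one_add, Units.val_mul, mul_assoc, coeff_t_mul, ih]
    congr 1
    ring
  | pred k ih =>
    rw [sub_eq_neg_add, zpow_add, zpow_neg_one, Units.val_mul, mul_assoc, coeff_t_inv_mul, ih]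
    congr 1
    ring

theorem coeff_c_mul_t_zpow (a : A) (k : ℤ) :
    D.coeff (D.c a * ((D.t ^ k : Bˣ) : B)) = Finsupp.single k a := by
  ext n
  rw [D.coeff_c_mul, ← mul_one ((D.t ^ k : Bˣ) : B), coeff_t_zpow_mul, D.coeff_one,
    Finsupp.single_apply, Finsupp.single_apply]
  split_ifs <;> first | omega | simp

theorem coeff_injective : Function.Injective D.coeff := fun b b' h => by
  rw [← D.sum_coeff b, ← D.sum_coeff b', h]

/-- The element with prescribed coefficients. -/
def ofCoeff : (ℤ →₀ A) →+ B :=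
  Finsupp.liftAddHom fun n => (AddMonoidHom.mulRight ((D.t ^ n : Bˣ) : B)).comp D.c.toAddMonoidHom

theorem coeff_ofCoeff (f : ℤ →₀ A) : D.coeff (D.ofCoeff f) = f := by
  have : D.coeff.comp D.ofCoeff = AddMonoidHom.id _ := by
    ext n a : 2
    simp [ofCoeff, D.coeff_c_mul_t_zpow]
  exact DFunLike.congr_fun this f

/-- The structure only prescribes coefficients under left multiplication by constants; centrality of
t yields the right-hand version, needed for balanced tensors. -/
theorem coeff_mul_c (b : B) (a : A) (n : ℤ) : D.coeff (b * D.c a) n = D.coeff b n * a := by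
  have h : b * D.c a = D.ofCoeff ((D.coeff b).mapRange (· * a) (zero_mul a)) := by
    conv_lhs => rw [← D.sum_coeff b]
    rw [ofCoeff, Finsupp.liftAddHom_apply, Finsupp.sum_mapRange_index (by simp), Finsupp.sum_mul]
    refine Finsupp.sum_congr fun n _ => ?_
    simp [mul_assoc, D.t_zpow_comm]
  rw [h, coeff_ofCoeff, Finsupp.mapRange_apply]

/-- The truncation to non-negative powers of `t`. -/
def pos : B →+ B :=
  D.ofCoeff.comp ((Finsupp.filterAddHom (fun n : ℤ => 0 ≤ n)).comp D.coeff)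

theorem coeff_pos (b : B) (n : ℤ) : D.coeff (D.pos b) n = if 0 ≤ n then D.coeff b n else 0 := by
  simp only [pos, AddMonoidHom.comp_apply, coeff_ofCoeff]
  exact Finsupp.filter_apply _ _ _

theorem pos_c_mul (a : A) (b : B) : D.pos (D.c a * b) = D.c a * D.pos b := by
  refine D.coeff_injective (Finsupp.ext fun n => ?_)
  rw [coeff_c_mul, coeff_pos, coeff_pos, coeff_c_mul]
  split_ifs <;> simp

theorem pos_eq_self {b : B} (h : ∀ n < 0, D.coeff b n = 0) : D.pos b = b := by
  refine D.coeff_injective (Finsupp.ext fun n => ?_)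
  rw [coeff_pos]
  split_ifs with hn
  · rfl
  · exact (h n (not_le.1 hn)).symm

/-- The coefficients of a product vanish outside the range expected from the factors. -/
theorem coeff_mul_eq_zero {b b' : B} {k l : ℤ} (h : ∀ n, k < n → D.coeff b n = 0)
    (h' : ∀ n, l < n → D.coeff b' n = 0) (n : ℤ) (hn : k + l < n) : D.coeff (b * b') n = 0 := by
  rw [← D.sum_coeff b, Finsupp.sum, Finset.sum_mul, map_sum, Finsupp.finsetSum_apply]
  refine Finset.sum_eq_zero fun j hj => ?_
  have hj' : j ≤ k := by
    by_contra hjk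
    exact Finsupp.mem_support_iff.1 hj (h j (not_le.1 hjk))
  rw [mul_assoc, D.coeff_c_mul, D.coeff_t_zpow_mul, h' _ (by omega), mul_zero]

theorem exists_coeff_bound (b : B) : ∃ k : ℕ, ∀ n : ℤ, (k : ℤ) < |n| → D.coeff b n = 0 := by
  refine ⟨(D.coeff b).support.sup Int.natAbs, fun n hn => ?_⟩
  by_contra hne
  have := Finset.le_sup (f := Int.natAbs) (Finsupp.mem_support_iff.2 hne)
  rw [Int.abs_eq_natAbs] at hn
  omega

theorem exists_coeff_bound_family {ι : Type*} [Finite ι] (b : ι → B) :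
    ∃ k : ℕ, ∀ i, ∀ n : ℤ, (k : ℤ) < |n| → D.coeff (b i) n = 0 := by
  cases nonempty_fintype ι
  choose k hk using fun i => D.exists_coeff_bound (b i)
  refine ⟨Finset.univ.sup k, fun i n hn => hk i n ?_⟩
  have := Finset.le_sup (f := k) (Finset.mem_univ i)
  exact lt_of_le_of_lt (by exact_mod_cast this) hn

section Lattice

variable {M : Type u} [AddCommGroup M] [Module B M] [Module A M]

/-- A dual basis of the `A[t]`-lattice `P` in the `A[t, t⁻¹]`-module `M`. -/
structure LatticeBasis (P : Submodule A M) where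
  k : ℕ
  m : Fin k → M
  ψ : Fin k → M →ₗ[B] B
  smul_mem : ∀ x ∈ P, (D.t : B) • x ∈ P
  m_mem : ∀ i, m i ∈ P
  coeff_ψ : ∀ i, ∀ x ∈ P, ∀ n < 0, D.coeff (ψ i x) n = 0
  sum_smul : ∀ x, ∑ i, ψ i x • m i = x

variable {D}

theorem LatticeBasis.zpow_smul_mem {P : Submodule A M} (β : D.LatticeBasis P) {n : ℤ}
    (hn : 0 ≤ n) {x : M} (hx : x ∈ P) : ((D.t ^ n : Bˣ) : B) • x ∈ P := by
  lift n to ℕ using hn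
  induction n with
  | zero => simpa using hx
  | succ n ih =>
    rw [Nat.cast_succ, add_comm, zpow_one_add, Units.val_mul, mul_smul]
    exact β.smul_mem _ ih

theorem LatticeBasis.smul_mem_of_coeff (hM : ∀ (a : A) (x : M), a • x = D.c a • x)
    {P : Submodule A M} (β : D.LatticeBasis P) {b : B} (h : ∀ n < 0, D.coeff b n = 0) {x : M}
    (hx : x ∈ P) : b • x ∈ P := by
  rw [← D.sum_coeff b, Finsupp.sum, Finset.sum_smul]
  refine P.sum_mem fun n hn => ?_
  rw [mul_smul, ← hM]
  refine P.smul_mem _ (β.zpow_smul_mem ?_ hx)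
  by_contra hn'
  exact Finsupp.mem_support_iff.1 hn (h n (not_le.1 hn'))

/-- The `A`-linear retraction of `M` onto a lattice. -/
theorem LatticeBasis.exists_retraction (hM : ∀ (a : A) (x : M), a • x = D.c a • x)
    {P : Submodule A M} (β : D.LatticeBasis P) :
    ∃ ρ : M →ₗ[A] M, (∀ x, ρ x ∈ P) ∧ ∀ x ∈ P, ρ x = x := by
  -- Truncating the coordinates to non-negative powers of t is `A`-linear, lands in the lattice, and
  -- changes nothing on it.
  refine ⟨{ toFun := fun x => ∑ i, D.pos (β.ψ i x) • β.m i, map_add' := ?_, map_smul' := ?_ },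
    fun x => ?_, fun x hx => ?_⟩
  · intro x y
    simp only [map_add, add_smul, Finset.sum_add_distrib]
  · intro a x
    simp only [hM, map_smul, smul_eq_mul, D.pos_c_mul, mul_smul, Finset.smul_sum,
      RingHom.id_apply]
  · change ∑ i, D.pos (β.ψ i x) • β.m i ∈ P
    refine P.sum_mem fun i _ => β.smul_mem_of_coeff hM (fun n hn => ?_) (β.m_mem i)
    rw [D.coeff_pos, if_neg (not_le.2 hn)]
  · change ∑ i, D.pos (β.ψ i x) • β.m i = x
    conv_rhs => rw [← β.sum_smul x]
    refine Finset.sum_congr rfl fun i _ => ?_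
    rw [D.pos_eq_self (β.coeff_ψ i x hx)]

/-- `B` is free over `A` on the powers of t, so the dual basis displays `M` as a direct summand of a
free `A`-module. -/
theorem LatticeBasis.projective (hM : ∀ (a : A) (x : M), a • x = D.c a • x)
    {P : Submodule A M} (β : D.LatticeBasis P) : Module.Projective A M := by
  let s : M →ₗ[A] (Fin β.k → ℤ →₀ A) :=
    { toFun := fun x i => D.coeff (β.ψ i x)
      map_add' := fun x y => by
        ext i : 1
        simp
      map_smul' := fun a x => by
        ext i n
        simp [hM, D.coeff_c_mul] }
  let π : (Fin β.k → ℤ →₀ A) →ₗ[A] M :=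
    ∑ i, (Finsupp.linearCombination A fun n : ℤ => ((D.t ^ n : Bˣ) : B) • β.m i) ∘ₗ
      LinearMap.proj i
  refine Module.Projective.of_split s π (LinearMap.ext fun x => ?_)
  simp only [π, s, LinearMap.comp_apply, LinearMap.sum_apply, LinearMap.proj_apply,
    LinearMap.coe_mk, AddHom.coe_mk, LinearMap.id_apply, Finsupp.linearCombination_apply]
  conv_rhs => rw [← β.sum_smul x]
  refine Finset.sum_congr rfl fun i _ => ?_
  conv_rhs => rw [← D.sum_coeff (β.ψ i x)]
  rw [Finsupp.sum, Finsupp.sum, Finset.sum_smul]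
  refine Finset.sum_congr rfl fun n _ => ?_
  rw [hM, mul_smul]

/-- The intersection of two direct summands which together span a projective module is a direct
summand. -/
theorem exists_retraction_inf [Module.Projective A M] {P N : Submodule A M} {ρ ρ' : M →ₗ[A] M}
    (hρ : ∀ x, ρ x ∈ P) (hρ₁ : ∀ x ∈ P, ρ x = x) (hρ' : ∀ x, ρ' x ∈ N)
    (hρ'₁ : ∀ x ∈ N, ρ' x = x) (h : P ⊔ N = ⊤) :
    ∃ σ : M →ₗ[A] M, (∀ x, σ x ∈ P ⊓ N) ∧ ∀ x ∈ P ⊓ N, σ x = x := by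
  have hproj : Module.Projective A (M ⧸ N) := by
    refine Module.Projective.of_split (N.liftQ (LinearMap.id - ρ') fun x hx => ?_) N.mkQ ?_
    · simp [hρ'₁ x hx]
    · ext x
      simpa using hρ' x
  have hsurj : Function.Surjective (N.mkQ ∘ₗ P.subtype) := by
    intro y
    obtain ⟨x, rfl⟩ := N.mkQ_surjective y
    obtain ⟨p, hp, q, hq, rfl⟩ := Submodule.mem_sup.1 (h ▸ Submodule.mem_top : x ∈ P ⊔ N)
    refine ⟨⟨p, hp⟩, ?_⟩
    simpa [sub_eq_zero] using hq
  obtain ⟨s, hs⟩ := Module.projective_lifting_property (N.mkQ ∘ₗ P.subtype) LinearMap.id hsurj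
  -- Here `s` is a section of P → M/N, which is onto because P + N = M and splits because M/N is
  -- projective. Subtracting `s` of the class of `ρ x` from `ρ x` moves it into `N` without leaving
  -- `P`.
  refine ⟨ρ - P.subtype ∘ₗ s ∘ₗ N.mkQ ∘ₗ ρ, fun x => ⟨?_, ?_⟩, fun x hx => ?_⟩
  · exact P.sub_mem (hρ x) (s _).2
  · refine (Submodule.Quotient.mk_eq_zero N).1 ?_
    change N.mkQ _ = 0
    rw [LinearMap.sub_apply, map_sub, sub_eq_zero]
    exact (LinearMap.congr_fun hs (N.mkQ (ρ x))).symm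
  · have : N.mkQ x = 0 := by simpa using hx.2
    simp only [LinearMap.sub_apply, LinearMap.comp_apply, hρ₁ x hx.1, this, map_zero, sub_zero]

/-- Sections over the whole line have bounded degree: membership in `P` bounds the coordinates from
below, membership in `N` from above. So P ∩ N lies in a finitely generated `A`-module, and it is a
direct summand of the projective module `M`. -/
theorem LatticeBasis.fg_projective_inf (hM : ∀ (a : A) (x : M), a • x = D.c a • x)
    {P N : Submodule A M} (β : D.LatticeBasis P) (γ : D.symm.LatticeBasis N)
    (h : P ⊔ N = ⊤) :
    Module.Finite A ↥(P ⊓ N) ∧ Module.Projective A ↥(P ⊓ N) := by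
  have := β.projective hM
  obtain ⟨ρ, hρ, hρ₁⟩ := β.exists_retraction hM
  obtain ⟨ρ', hρ', hρ'₁⟩ := LatticeBasis.exists_retraction (D := D.symm) hM γ
  obtain ⟨σ, hσ, hσ₁⟩ := exists_retraction_inf hρ hρ₁ hρ' hρ'₁ h
  refine ⟨?_, Module.Projective.of_split (P ⊓ N).subtype (σ.codRestrict _ hσ)
    (LinearMap.ext fun x => Subtype.ext (hσ₁ x x.2))⟩
  obtain ⟨l, hl⟩ := D.exists_coeff_bound_family fun p : Fin β.k × Fin γ.k => β.ψ p.1 (γ.m p.2)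
  have hdeg : ∀ x ∈ N, ∀ i, ∀ n : ℤ, (l : ℤ) < n → D.coeff (β.ψ i x) n = 0 := by
    intro x hx i n hn
    rw [← γ.sum_smul x, map_sum, map_sum, Finsupp.finsetSum_apply]
    refine Finset.sum_eq_zero fun j _ => ?_
    rw [map_smul, smul_eq_mul]
    refine D.coeff_mul_eq_zero (k := 0) (l := l) (fun n hn => ?_) (fun n hn => ?_) n (by omega)
    · have := γ.coeff_ψ j x hx (-n) (by omega)
      rwa [symm_coeff, neg_neg] at this
    · exact hl (i, j) n (lt_of_lt_of_le hn (le_abs_self n))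
  let F : Submodule A M := Submodule.span A
    ((fun p : Fin β.k × ℤ => ((D.t ^ p.2 : Bˣ) : B) • β.m p.1) ''
      (Set.univ ×ˢ Set.Icc (0 : ℤ) l))
  have hF : F.FG := Submodule.fg_span ((Set.finite_univ.prod (Set.finite_Icc _ _)).image _)
  have hle : P ⊓ N ≤ F := by
    intro x hx
    rw [← β.sum_smul x]
    refine F.sum_mem fun i _ => ?_
    rw [← D.sum_coeff (β.ψ i x), Finsupp.sum, Finset.sum_smul]
    refine F.sum_mem fun n hn => ?_
    rw [mul_smul, ← hM]
    refine F.smul_mem _ (Submodule.subset_span ⟨(i, n), ⟨trivial, ?_⟩, rfl⟩)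
    have hne := Finsupp.mem_support_iff.1 hn
    constructor <;> by_contra hn'
    · exact hne (β.coeff_ψ i x hx.1 n (not_le.1 hn'))
    · exact hne (hdeg x hx.2 i n (not_le.1 hn'))
  -- `F` need not be contained in `N`, so finite generation is obtained by projecting it onto P ∩ N.
  have heq : F.map σ = P ⊓ N := by
    refine le_antisymm ?_ fun x hx => ⟨x, hle hx, hσ₁ x hx⟩
    rintro _ ⟨x, _, rfl⟩
    exact hσ x
  rw [Module.Finite.iff_fg, ← heq]
  exact hF.map σ

/-- The translate `t^k N` of a lattice. -/
def translate (hM : ∀ (a : A) (x : M), a • x = D.c a • x) (k : ℤ) (N : Submodule A M) :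
    Submodule A M where
  carrier := {x | ((D.t ^ (-k) : Bˣ) : B) • x ∈ N}
  zero_mem' := by simp
  add_mem' hx hy := by
    rw [Set.mem_ofPred_eq, smul_add]
    exact N.add_mem hx hy
  smul_mem' a x hx := by
    rw [Set.mem_ofPred_eq, hM, ← mul_smul, D.t_zpow_comm, mul_smul, ← hM]
    exact N.smul_mem a hx

theorem mem_translate {hM : ∀ (a : A) (x : M), a • x = D.c a • x} {k : ℤ} {N : Submodule A M}
    {x : M} : x ∈ translate hM k N ↔ ((D.t ^ (-k) : Bˣ) : B) • x ∈ N := Iff.rfl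

/-- The translate of a dual basis. -/
def LatticeBasis.translate (hM : ∀ (a : A) (x : M), a • x = D.c a • x) {N : Submodule A M}
    (γ : D.symm.LatticeBasis N) (k : ℤ) :
    D.symm.LatticeBasis (LaurentRing.translate hM k N) where
  k := γ.k
  m i := ((D.t ^ k : Bˣ) : B) • γ.m i
  ψ i := LinearMap.toSpanSingleton B B ((D.t ^ (-k) : Bˣ) : B) ∘ₗ γ.ψ i
  smul_mem x hx := by
    rw [mem_translate, ← mul_smul, D.t_zpow_comm, mul_smul]
    exact γ.smul_mem _ hx
  m_mem i := by
    rw [mem_translate, ← mul_smul, ← Units.val_mul, ← zpow_add, neg_add_cancel, zpow_zero,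
      Units.val_one, one_smul]
    exact γ.m_mem i
  coeff_ψ i x hx n hn := by
    have := γ.coeff_ψ i _ hx n hn
    rwa [map_smul, smul_eq_mul, D.t_zpow_comm] at this
  sum_smul x := by
    conv_rhs => rw [← γ.sum_smul x]
    refine Finset.sum_congr rfl fun i _ => ?_
    rw [← mul_smul, LinearMap.comp_apply, LinearMap.toSpanSingleton_apply, smul_eq_mul, mul_assoc,
      ← Units.val_mul, ← zpow_add, neg_add_cancel, zpow_zero, Units.val_one, mul_one]

/-- Finitely many elements are contained in some translate of a lattice. -/
theorem LatticeBasis.exists_mem_translate (hM : ∀ (a : A) (x : M), a • x = D.c a • x)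
    {N : Submodule A M} (γ : D.symm.LatticeBasis N) {ι : Type*} [Finite ι] (x : ι → M) :
    ∃ k : ℤ, ∀ i, x i ∈ LaurentRing.translate hM k N := by
  obtain ⟨l, hl⟩ := D.exists_coeff_bound_family fun p : Fin γ.k × ι => γ.ψ p.1 (x p.2)
  -- All coordinates of the given elements have degree at most `l`; multiplication by t⁻ˡ makes
  -- these degrees non-positive.
  refine ⟨l, fun i => ?_⟩
  rw [mem_translate, ← γ.sum_smul (x i), Finset.smul_sum]
  refine N.sum_mem fun j _ => ?_
  rw [← mul_smul]
  refine LatticeBasis.smul_mem_of_coeff (D := D.symm) hM γ (fun n hn => ?_) (γ.m_mem j)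
  rw [symm_coeff, D.coeff_t_zpow_mul]
  exact hl (j, i) _ (lt_of_lt_of_le (by omega) (le_abs_self _))

/-- If the `A[t⁻¹]`-lattice `N` contains the generators of the `A[t]`-lattice `P`, then the
first cohomology of the sheaf twisted by `-1` vanishes. -/
theorem LatticeBasis.sup_translate_eq_top (hM : ∀ (a : A) (x : M), a • x = D.c a • x)
    {P N : Submodule A M} (β : D.LatticeBasis P) (γ : D.symm.LatticeBasis N)
    (h : ∀ i, β.m i ∈ N) : P ⊔ LaurentRing.translate hM (-1) N = ⊤ := by
  refine Submodule.eq_top_iff'.2 fun x => ?_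
  rw [← β.sum_smul x]
  refine Submodule.sum_mem _ fun i _ => ?_
  -- The non-negative part of the coefficient keeps `β.m i` in `P`. The rest has only strictly
  -- negative powers, hence sends `β.m i ∈ N` into t⁻¹N.
  have hb : β.ψ i x = D.pos (β.ψ i x) + (β.ψ i x - D.pos (β.ψ i x)) := by abel
  rw [hb, add_smul]
  refine Submodule.add_mem_sup (β.smul_mem_of_coeff hM (fun n hn => ?_) (β.m_mem i)) ?_
  · rw [D.coeff_pos, if_neg (not_le.2 hn)]
  · rw [mem_translate, ← mul_smul]
    refine LatticeBasis.smul_mem_of_coeff (D := D.symm) hM γ (fun n hn => ?_) (h i)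
    rw [symm_coeff, D.coeff_t_zpow_mul, map_sub D.coeff, Finsupp.sub_apply, D.coeff_pos,
      if_pos (by omega), sub_self]

end Lattice

end LaurentRing

/-! ### Coefficients in B ⊗_A X and the canonical resolution. -/

section ExtensionOfScalarsElements

variable {A B : Type u} [Ring A] [Ring B] (f : A →+* B)

theorem extTmul_add_left (M : ModuleCat.{u} A) (b b' : B) (m : M) :
    extTmul f M (b + b') m = extTmul f M b m + extTmul f M b' m := by
  simp only [extTmul, TensorProduct.add_tmul]
  exact map_add _ _ _

/-- The additive map `b ↦ b ⊗ m`. -/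
def extTmulLeft (M : ModuleCat.{u} A) (m : M) : B →+ extObj f M :=
  AddMonoidHom.mk' (fun b => extTmul f M b m) fun b b' => extTmul_add_left f M b b' m

/-- The additive map `m ↦ b ⊗ m`. -/
def extTmulRight (M : ModuleCat.{u} A) (b : B) : M →+ extObj f M :=
  AddMonoidHom.mk' (fun m => extTmul f M b m) fun m m' => extTmul_add f M b m m'

theorem ext_induction {M : ModuleCat.{u} A} {p : extObj f M → Prop} (z : extObj f M)
    (tmul : ∀ b m, p (extTmul f M b m)) (add : ∀ x y, p x → p y → p (x + y)) : p z := by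
  obtain ⟨t, rfl⟩ := (balancedRelations f M).mkQ_surjective z
  induction t with
  | zero =>
    have : (balancedRelations f M).mkQ 0 = extTmul f M 0 0 := by
      simp only [extTmul, TensorProduct.zero_tmul]
    rw [this]
    exact tmul 0 0
  | tmul b m => exact tmul b m
  | add s t hs ht =>
    rw [map_add]
    exact add _ _ hs ht

end ExtensionOfScalarsElements

namespace LaurentRing

variable {A B : Type u} [Ring A] [Ring B] (D : LaurentRing A B)

/-- The coefficient of `tⁿ` in `B ⊗_A X = ⨁ tⁿ X`. -/
def extCoeff (X : ModuleCat.{u} A) (n : ℤ) : extObj D.c X →+ X :=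
  let φ : B ⊗[ℤ] X →ₗ[ℤ] X := TensorProduct.lift
    (LinearMap.mk₂ ℤ (fun b (x : X) => D.coeff b n • x) (by simp [add_smul]) (by
      intro k b x
      rw [map_zsmul, Finsupp.smul_apply, smul_assoc]) (by simp) (by
      intro k b x
      rw [smul_comm]))
  QuotientAddGroup.lift (balancedRelations D.c X).toAddSubgroup φ.toAddMonoidHom (by
    intro x hx
    -- The coefficient map is not `B`-linear, so the induction over the `B`-span needs the statement
    -- for all multiples at once.
    have key : ∀ b : B, φ (b • x) = 0 := by
      replace hx : x ∈ balancedRelations D.c X := hx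
      induction hx using Submodule.span_induction with
      | mem x hx =>
        obtain ⟨b', a, m, rfl⟩ := hx
        intro b
        rw [smul_sub, map_sub, TensorProduct.smul_tmul', TensorProduct.smul_tmul', sub_eq_zero]
        change D.coeff (b * (b' * D.c a)) n • m = D.coeff (b * b') n • a • m
        rw [← mul_assoc, D.coeff_mul_c, mul_smul]
      | zero => simp
      | add x y _ _ hx hy =>
        intro b
        rw [smul_add, map_add, hx, hy, add_zero]
      | smul c x _ hx =>
        intro b
        rw [smul_smul]
        exact hx _
    simpa using key 1)

theorem extCoeff_tmul (X : ModuleCat.{u} A) (n : ℤ) (b : B) (x : X) :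
    D.extCoeff X n (extTmul D.c X b x) = D.coeff b n • x := rfl

/-- The element `∑ tⁿ ⊗ xₙ` of `B ⊗_A X`. -/
def extOfCoeff (X : ModuleCat.{u} A) : (ℤ →₀ X) →+ extObj D.c X :=
  Finsupp.liftAddHom fun n => extTmulRight D.c X ((D.t ^ n : Bˣ) : B)

theorem coeff_t_zpow (k n : ℤ) : D.coeff ((D.t ^ k : Bˣ) : B) n = if k = n then 1 else 0 := by
  have := D.coeff_c_mul_t_zpow 1 k
  rw [map_one, one_mul] at this
  rw [this, Finsupp.single_apply]

theorem extCoeff_extOfCoeff (X : ModuleCat.{u} A) (f : ℤ →₀ X) (n : ℤ) :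
    D.extCoeff X n (D.extOfCoeff X f) = f n := by
  have : (D.extCoeff X n).comp (D.extOfCoeff X) = Finsupp.applyAddHom n := by
    ext k x
    simp only [extOfCoeff, AddMonoidHom.comp_apply, Finsupp.singleAddHom_apply,
      Finsupp.liftAddHom_apply_single, Finsupp.applyAddHom_apply]
    change D.extCoeff X n (extTmul D.c X _ x) = _
    rw [extCoeff_tmul, coeff_t_zpow, Finsupp.single_apply]
    split_ifs <;> simp
  exact DFunLike.congr_fun this f

theorem exists_eq_extOfCoeff {X : ModuleCat.{u} A} (z : extObj D.c X) :
    ∃ f : ℤ →₀ X, z = D.extOfCoeff X f := by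
  induction z using ext_induction with
  | tmul b x =>
    refine ⟨(D.coeff b).mapRange (· • x) (zero_smul A x), ?_⟩
    rw [extOfCoeff, Finsupp.liftAddHom_apply, Finsupp.sum_mapRange_index (by simp)]
    conv_lhs => rw [← D.sum_coeff b]
    change extTmulLeft D.c X x _ = _
    rw [Finsupp.sum, map_sum]
    refine Finset.sum_congr rfl fun n _ => ?_
    change extTmul D.c X _ x = extTmul D.c X _ _
    rw [← extTmul_balanced, D.t_zpow_comm]
  | add x y hx hy =>
    obtain ⟨f, rfl⟩ := hx
    obtain ⟨g, rfl⟩ := hy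
    exact ⟨f + g, (map_add _ _ _).symm⟩

theorem ext_of_extCoeff {X : ModuleCat.{u} A} {z w : extObj D.c X}
    (h : ∀ n, D.extCoeff X n z = D.extCoeff X n w) : z = w := by
  obtain ⟨f, rfl⟩ := D.exists_eq_extOfCoeff z
  obtain ⟨g, rfl⟩ := D.exists_eq_extOfCoeff w
  simp only [extCoeff_extOfCoeff] at h
  rw [Finsupp.ext h]

section Resolution

variable {D} {M : Type u} [AddCommGroup M] [Module B M] [Module A M]

/-- The canonical map `B ⊗_A H ⟶ M`. -/
def resolutionπ (hM : ∀ (a : A) (x : M), a • x = D.c a • x) (H : Submodule A M) :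
    extObj D.c (ModuleCat.of A H) ⟶ ModuleCat.of B M :=
  extLift D.c (ModuleCat.of A H) (ModuleCat.of B M) (ModuleCat.ofHom
    (Y := (ModuleCat.restrictScalars D.c).obj (ModuleCat.of B M))
    { toFun := fun x => (x : M)
      map_add' := fun _ _ => rfl
      map_smul' := fun a x => hM a x })

theorem resolutionπ_tmul (hM : ∀ (a : A) (x : M), a • x = D.c a • x) (H : Submodule A M)
    (b : B) (x : H) : (resolutionπ hM H).hom (extTmul D.c (ModuleCat.of A H) b x) =
      b • (x : M) := rfl

/-- The element `1 ⊗ t x - t ⊗ x`. -/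
def resolutionElt {H' H : Submodule A M} (h : H' ≤ H) (ht : ∀ x ∈ H', (D.t : B) • x ∈ H)
    (x : H') : extObj D.c (ModuleCat.of A H) :=
  extTmul D.c (ModuleCat.of A H) 1 ⟨(D.t : B) • (x : M), ht x x.2⟩ -
    extTmul D.c (ModuleCat.of A H) D.t ⟨x, h x.2⟩

theorem resolutionElt_add {H' H : Submodule A M} (h : H' ≤ H)
    (ht : ∀ x ∈ H', (D.t : B) • x ∈ H) (x y : H') :
    resolutionElt h ht (x + y) = resolutionElt h ht x + resolutionElt h ht y := by
  unfold resolutionElt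
  have h₁ := extTmul_add D.c (ModuleCat.of A H) 1 ⟨(D.t : B) • (x : M), ht x x.2⟩
    ⟨(D.t : B) • (y : M), ht y y.2⟩
  have h₂ := extTmul_add D.c (ModuleCat.of A H) D.t ⟨x, h x.2⟩ ⟨y, h y.2⟩
  rw [← add_sub_add_comm]
  refine congrArg₂ (· - ·) ?_ h₂
  rw [← h₁]
  exact congrArg (extTmul D.c (ModuleCat.of A H) 1) (Subtype.ext (smul_add _ _ _))

theorem resolutionElt_smul (hM : ∀ (a : A) (x : M), a • x = D.c a • x) {H' H : Submodule A M}
    (h : H' ≤ H) (ht : ∀ x ∈ H', (D.t : B) • x ∈ H) (a : A) (x : H') :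
    resolutionElt h ht (a • x) = D.c a • resolutionElt h ht x := by
  unfold resolutionElt
  rw [smul_sub, extTmul_smul, extTmul_smul, ← D.t_comm, mul_one]
  refine congrArg₂ (· - ·) ?_ (extTmul_balanced D.c (ModuleCat.of A H) D.t a ⟨x, h x.2⟩).symm
  rw [← one_mul (D.c a), extTmul_balanced]
  refine congrArg (extTmul D.c (ModuleCat.of A H) 1) (Subtype.ext ?_)
  change (D.t : B) • (a • (x : M)) = a • ((D.t : B) • (x : M))
  rw [hM, hM, ← mul_smul, ← mul_smul, D.t_comm]

/-- The map `B ⊗_A H' ⟶ B ⊗_A H`, `b ⊗ x ↦ b ⊗ t x - b t ⊗ x`. -/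
def resolutionι (hM : ∀ (a : A) (x : M), a • x = D.c a • x) {H' H : Submodule A M} (h : H' ≤ H)
    (ht : ∀ x ∈ H', (D.t : B) • x ∈ H) :
    extObj D.c (ModuleCat.of A H') ⟶ extObj D.c (ModuleCat.of A H) :=
  extLift D.c _ _ (ModuleCat.ofHom
    (Y := (ModuleCat.restrictScalars D.c).obj (extObj D.c (ModuleCat.of A H)))
    { toFun := resolutionElt h ht
      map_add' := resolutionElt_add h ht
      map_smul' := resolutionElt_smul hM h ht })

theorem resolutionι_tmul (hM : ∀ (a : A) (x : M), a • x = D.c a • x) {H' H : Submodule A M}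
    (h : H' ≤ H) (ht : ∀ x ∈ H', (D.t : B) • x ∈ H) (b : B) (x : H') :
    (resolutionι hM h ht).hom (extTmul D.c (ModuleCat.of A H') b x) =
      extTmul D.c (ModuleCat.of A H) b ⟨(D.t : B) • (x : M), ht x x.2⟩ -
        extTmul D.c (ModuleCat.of A H) (D.t * b) ⟨x, h x.2⟩ := by
  refine (extLift_tmul D.c (ModuleCat.of A H') _ _ b x).trans ?_
  change b • resolutionElt h ht x = _
  rw [resolutionElt, smul_sub, extTmul_smul, extTmul_smul, mul_one, D.t_comm]

theorem extCoeff_resolutionι (hM : ∀ (a : A) (x : M), a • x = D.c a • x) {H' H : Submodule A M}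
    (h : H' ≤ H) (ht : ∀ x ∈ H', (D.t : B) • x ∈ H) (n : ℤ)
    (z : extObj D.c (ModuleCat.of A H')) :
    ((D.extCoeff (ModuleCat.of A H) n ((resolutionι hM h ht).hom z) : H) : M) =
      (D.t : B) • ((D.extCoeff (ModuleCat.of A H') n z : H') : M) -
        ((D.extCoeff (ModuleCat.of A H') (n - 1) z : H') : M) := by
  induction z using ext_induction with
  | tmul b x =>
    rw [resolutionι_tmul, map_sub, extCoeff_tmul, extCoeff_tmul, extCoeff_tmul, extCoeff_tmul,
      D.coeff_t_mul]
    change D.coeff b n • ((D.t : B) • (x : M)) - D.coeff b (n - 1) • (x : M) =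
      (D.t : B) • (D.coeff b n • (x : M)) - D.coeff b (n - 1) • (x : M)
    rw [hM, hM _ (x : M), hM _ (x : M), ← mul_smul, ← mul_smul, D.t_comm]
  | add x y hx hy =>
    simp only [map_add, Submodule.coe_add, hx, hy, smul_add]
    abel

theorem resolutionπ_extOfCoeff (hM : ∀ (a : A) (x : M), a • x = D.c a • x) (H : Submodule A M)
    (f : ℤ →₀ H) : (resolutionπ hM H).hom (D.extOfCoeff (ModuleCat.of A H) f) =
      f.sum fun n x => ((D.t ^ n : Bˣ) : B) • (x : M) := by
  rw [extOfCoeff, Finsupp.liftAddHom_apply, Finsupp.sum, map_sum]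
  rfl

theorem resolution_comp (hM : ∀ (a : A) (x : M), a • x = D.c a • x) {H' H : Submodule A M}
    (h : H' ≤ H) (ht : ∀ x ∈ H', (D.t : B) • x ∈ H) :
    resolutionι hM h ht ≫ resolutionπ hM H = 0 := by
  ext z
  change (resolutionπ hM H).hom ((resolutionι hM h ht).hom z) = 0
  induction z using ext_induction with
  | tmul b x =>
    rw [resolutionι_tmul, map_sub, resolutionπ_tmul, resolutionπ_tmul, D.t_comm, mul_smul]
    exact sub_self _
  | add x y hx hy => rw [map_add, map_add, hx, hy, add_zero]

/-- A kernel element with coefficients fₙ satisfies t fₙ = fₙ₋₁. As fₙ = 0 for large n, descending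
induction kills every coefficient. -/
theorem resolutionι_injective (hM : ∀ (a : A) (x : M), a • x = D.c a • x)
    {H' H : Submodule A M} (h : H' ≤ H) (ht : ∀ x ∈ H', (D.t : B) • x ∈ H) :
    Function.Injective (resolutionι hM h ht).hom := by
  rw [injective_iff_map_eq_zero]
  intro z hz
  obtain ⟨f, rfl⟩ := D.exists_eq_extOfCoeff z
  have key : ∀ n, (D.t : B) • ((f n : H') : M) = (f (n - 1) : H') := fun n => by
    have := extCoeff_resolutionι hM h ht n (D.extOfCoeff (ModuleCat.of A H') f)
    rw [hz, map_zero, extCoeff_extOfCoeff, extCoeff_extOfCoeff] at this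
    exact sub_eq_zero.1 this.symm
  have hf : f = 0 := by
    obtain ⟨b, hb⟩ : ∃ b : ℤ, ∀ n, b < n → f n = 0 := by
      obtain ⟨b, hb⟩ := f.support.finite_toSet.bddAbove
      refine ⟨b, fun n hn => ?_⟩
      by_contra hne
      exact not_le.2 hn (hb (Finsupp.mem_support_iff.2 hne))
    have : ∀ (k : ℕ) (n : ℤ), b < n + k → f n = 0 := by
      intro k
      induction k with
      | zero => exact fun n hn => hb n (by simpa using hn)
      | succ k ih =>
        intro n hn
        have h₁ := key (n + 1)
        rw [ih (n + 1) (by push_cast at hn; linarith), add_sub_cancel_right] at h₁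
        refine Subtype.ext (h₁.symm.trans ?_)
        exact smul_zero _
    ext1 n
    exact this (b + 1 - n).toNat n (by have := Int.self_le_toNat (b + 1 - n); linarith)
  rw [hf, map_zero]

/-- Exactness of the canonical resolution in the middle. -/
theorem resolution_exact (hM : ∀ (a : A) (x : M), a • x = D.c a • x) {P N : Submodule A M}
    (β : D.LatticeBasis P) (γ : D.symm.LatticeBasis N)
    (h : P ⊓ translate hM (-1) N ≤ P ⊓ N)
    (ht : ∀ x ∈ P ⊓ translate hM (-1) N, (D.t : B) • x ∈ P ⊓ N)
    (z : extObj D.c (ModuleCat.of A ↥(P ⊓ N))) (hz : (resolutionπ hM (P ⊓ N)).hom z = 0) :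
    ∃ w, (resolutionι hM h ht).hom w = z := by
  obtain ⟨f, rfl⟩ := D.exists_eq_extOfCoeff z
  rw [resolutionπ_extOfCoeff, Finsupp.sum] at hz
  -- A preimage with coefficients gₙ must solve t gₙ - gₙ₋₁ = fₙ, so gₙ is the sum over j ≤ n of
  -- tʲ⁻ⁿ⁻¹ fⱼ. These exponents are at most -1, which puts gₙ in t⁻¹N. Since ∑ tʲ fⱼ = 0, gₙ is also
  -- minus the sum over j > n, where the exponents are non-negative, which puts it in `P`.
  let τ : ℤ → ℤ → M := fun n j => ((D.t ^ (j - n - 1) : Bˣ) : B) • ((f j : ↥(P ⊓ N)) : M)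
  have hτ : ∀ n j, (D.t : B) • τ n j = τ (n - 1) j := fun n j => by
    simp only [τ]
    rw [← mul_smul, ← Units.val_mul, ← zpow_one_add,
      show 1 + (j - n - 1) = j - (n - 1) - 1 by ring]
  have hsum : ∀ n, ∑ j ∈ f.support, τ n j = 0 := fun n => by
    have : ∑ j ∈ f.support, τ n j = ((D.t ^ (-n - 1) : Bˣ) : B) •
        ∑ j ∈ f.support, ((D.t ^ j : Bˣ) : B) • ((f j : ↥(P ⊓ N)) : M) := by
      rw [Finset.smul_sum]
      refine Finset.sum_congr rfl fun j _ => ?_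
      simp only [τ]
      rw [← mul_smul, ← Units.val_mul, ← zpow_add]
      congr 4
      ring
    rw [this, hz, smul_zero]
  let g : ℤ → M := fun n => ∑ j ∈ f.support with j ≤ n, τ n j
  have hg : ∀ n, g n = -∑ j ∈ f.support with ¬ j ≤ n, τ n j := fun n => by
    rw [eq_neg_iff_add_eq_zero, ← hsum n]
    exact Finset.sum_filter_add_sum_filter_not _ _ _
  have hgN : ∀ n, g n ∈ translate hM (-1) N := fun n => by
    refine Submodule.sum_mem _ fun j hj => ?_
    rw [mem_translate, ← mul_smul, ← Units.val_mul, ← zpow_add]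
    have := LatticeBasis.zpow_smul_mem (D := D.symm) γ
      (n := -(- -1 + (j - n - 1))) (by have := (Finset.mem_filter.1 hj).2; omega) (f j).2.2
    change (((D.t⁻¹) ^ _ : Bˣ) : B) • _ ∈ N at this
    rwa [inv_zpow', neg_neg] at this
  have hgP : ∀ n, g n ∈ P := fun n => by
    rw [hg]
    refine P.neg_mem (P.sum_mem fun j hj => ?_)
    exact β.zpow_smul_mem (by have := (Finset.mem_filter.1 hj).2; omega) (f j).2.1
  have hrec : ∀ n, (D.t : B) • g n - g (n - 1) = ((f n : ↥(P ⊓ N)) : M) := fun n => by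
    have h₁ : (D.t : B) • g n = ∑ j ∈ f.support with j ≤ n, τ (n - 1) j := by
      simp only [g]
      rw [Finset.smul_sum]
      exact Finset.sum_congr rfl fun j _ => hτ n j
    have h₂ : ∀ j ∈ f.support, (if j ≤ n then τ (n - 1) j else 0) =
        (if j ≤ n - 1 then τ (n - 1) j else 0) +
          if n = j then ((f n : ↥(P ⊓ N)) : M) else 0 := by
      intro j _
      rcases lt_trichotomy j n with hj | rfl | hj
      · rw [if_pos hj.le, if_pos (by omega), if_neg (by omega), add_zero]
      · rw [if_pos le_rfl, if_neg (by omega), if_pos rfl, zero_add]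
        simp only [τ]
        rw [show j - (j - 1) - 1 = 0 by ring, zpow_zero, Units.val_one, one_smul]
      · rw [if_neg (by omega), if_neg (by omega), if_neg (by omega), add_zero]
    rw [h₁, sub_eq_iff_eq_add']
    simp only [g]
    rw [Finset.sum_filter, Finset.sum_filter, Finset.sum_congr rfl h₂, Finset.sum_add_distrib,
      Finset.sum_ite_eq]
    split_ifs with hn
    · rfl
    · rw [Finsupp.notMem_support_iff.1 hn]
      rfl
  -- Below the support of `f` the first sum for gₙ is empty, above it the second one is; hence `g`
  -- has finite support.
  let G : ℤ →₀ ↥(P ⊓ translate hM (-1) N) := Finsupp.onFinset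
    (Finset.Icc (-(f.support.sup Int.natAbs : ℕ) : ℤ) (f.support.sup Int.natAbs : ℕ))
    (fun n => ⟨g n, hgP n, hgN n⟩) (by
      intro n hn
      have hn' : g n ≠ 0 := fun h0 => hn (Subtype.ext h0)
      rw [Finset.mem_Icc]
      constructor <;> by_contra hlt
      · refine hn' (Finset.sum_eq_zero fun j hj => ?_)
        obtain ⟨hj, hjn⟩ := Finset.mem_filter.1 hj
        have := Finset.le_sup (f := Int.natAbs) hj
        omega
      · refine hn' ?_
        rw [hg, neg_eq_zero]
        refine Finset.sum_eq_zero fun j hj => ?_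
        obtain ⟨hj, hjn⟩ := Finset.mem_filter.1 hj
        have := Finset.le_sup (f := Int.natAbs) hj
        omega)
  refine ⟨D.extOfCoeff _ G, D.ext_of_extCoeff fun n => Subtype.ext ?_⟩
  rw [extCoeff_resolutionι, extCoeff_extOfCoeff, extCoeff_extOfCoeff, extCoeff_extOfCoeff]
  exact hrec n

/-- The canonical resolution `0 ⟶ B ⊗ H' ⟶ B ⊗ H ⟶ M ⟶ 0`. -/
theorem exists_resolution (hM : ∀ (a : A) (x : M), a • x = D.c a • x) {P N : Submodule A M}
    (β : D.LatticeBasis P) (γ : D.symm.LatticeBasis N) :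
    ∃ (H' H : ModuleCat.{u} A) (ι : extObj D.c H' ⟶ extObj D.c H)
      (π : extObj D.c H ⟶ ModuleCat.of B M) (w : ι ≫ π = 0),
      (Module.Finite A H' ∧ Module.Projective A H') ∧ (Module.Finite A H ∧ Module.Projective A H) ∧
        (ShortComplex.mk ι π w).ShortExact := by
  -- The twist is chosen so that N₀ contains the generators of `P`. This gives P + t⁻¹N₀ = M, and
  -- then P + N₀ = M as well.
  obtain ⟨k, hk⟩ := γ.exists_mem_translate hM β.m
  let N₀ := translate hM k N
  let γ₀ : D.symm.LatticeBasis N₀ := γ.translate hM k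
  have hle : translate hM (-1) N₀ ≤ N₀ := fun x hx => by
    have h₁ := γ₀.smul_mem _ hx
    change ((D.t⁻¹ : Bˣ) : B) • _ ∈ _ at h₁
    rwa [← mul_smul, ← Units.val_mul, neg_neg, zpow_one, inv_mul_cancel, Units.val_one,
      one_smul] at h₁
  have h : P ⊓ translate hM (-1) N₀ ≤ P ⊓ N₀ := inf_le_inf_left _ hle
  have ht : ∀ x ∈ P ⊓ translate hM (-1) N₀, (D.t : B) • x ∈ P ⊓ N₀ := fun x hx => by
    refine ⟨β.smul_mem x hx.1, ?_⟩
    have := hx.2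
    rwa [SetLike.mem_coe, mem_translate, neg_neg, zpow_one] at this
  have htop' := β.sup_translate_eq_top hM γ₀ hk
  have htop : P ⊔ N₀ = ⊤ := top_le_iff.1 (htop' ▸ sup_le_sup_left hle P)
  refine ⟨ModuleCat.of A ↥(P ⊓ translate hM (-1) N₀), ModuleCat.of A ↥(P ⊓ N₀),
    resolutionι hM h ht, resolutionπ hM _, resolution_comp hM h ht,
    β.fg_projective_inf hM (γ₀.translate hM (-1)) htop', β.fg_projective_inf hM γ₀ htop, ?_⟩
  exact
    { exact := by
        rw [ShortComplex.moduleCat_exact_iff]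
        exact fun z hz => resolution_exact hM β γ₀ h ht z hz
      mono_f := (ModuleCat.mono_iff_injective _).2 (resolutionι_injective hM h ht)
      epi_g := by
        refine (ModuleCat.epi_iff_surjective _).2 fun x => ?_
        refine ⟨∑ i, extTmul D.c (ModuleCat.of A ↥(P ⊓ N₀)) (β.ψ i x) ⟨β.m i, β.m_mem i, hk i⟩, ?_⟩
        refine (map_sum (resolutionπ hM (P ⊓ N₀)).hom _ _).trans ?_
        exact β.sum_smul x }

end Resolution

end LaurentRing

/-! ### Laurent polynomials over R, through opposite rings because modules are right modules. -/

section ConcreteLaurent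

variable (R : Type u) [Ring R]

open LaurentPolynomial MulOpposite

theorem LaurentPolynomial.coeff_C_mul_T {R : Type u} [Ring R] (r : R) (k n : ℤ) :
    (LaurentPolynomial.C r * T k).coeff n = if k = n then r else 0 := by
  rw [← single_eq_C_mul_T, AddMonoidAlgebra.coeff_single, Finsupp.single_apply]

/-- The opposite ring of `R[x, x⁻¹]` is a Laurent polynomial ring over the opposite of `R`. -/
def laurentOp : LaurentRing Rᵐᵒᵖ (LaurentPolynomial R)ᵐᵒᵖ where
  c := (LaurentPolynomial.C (R := R)).op
  t := ⟨op (T 1), op (T (-1)), by rw [← op_mul, ← T_add]; simp,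
    by rw [← op_mul, ← T_add]; simp⟩
  t_comm b := by
    obtain ⟨p, rfl⟩ := op_surjective b
    simp only [← op_mul]
    rw [(commute_T 1 p).eq]
  coeff := AddMonoidHom.mk' (fun b => ((unop b).coeff).mapRange op rfl) fun b b' => by
    ext n
    simp
  coeff_one := by
    ext n
    change op ((1 : LaurentPolynomial R).coeff n) = _
    rw [← T_zero, T_apply, Finsupp.single_apply]
    split_ifs <;> rfl
  coeff_c_mul a b n := by
    obtain ⟨r, rfl⟩ := op_surjective a
    obtain ⟨p, rfl⟩ := op_surjective b
    change op ((p * LaurentPolynomial.C r).coeff n) = op (p.coeff n * r)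
    congr 1
    induction p using LaurentPolynomial.induction_on' with
    | add p q hp hq =>
      rw [add_mul, AddMonoidAlgebra.coeff_add, AddMonoidAlgebra.coeff_add, Finsupp.add_apply,
        Finsupp.add_apply, hp, hq, add_mul]
    | C_mul_T k s =>
      rw [mul_assoc, (commute_T k _).eq, ← mul_assoc, ← map_mul, coeff_C_mul_T, coeff_C_mul_T]
      split_ifs <;> simp
  coeff_t_mul b n := by
    obtain ⟨p, rfl⟩ := op_surjective b
    change op ((p * T 1).coeff n) = op (p.coeff (n - 1))
    congr 1
    induction p using LaurentPolynomial.induction_on' with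
    | add p q hp hq =>
      rw [add_mul, AddMonoidAlgebra.coeff_add, AddMonoidAlgebra.coeff_add, Finsupp.add_apply,
        Finsupp.add_apply, hp, hq]
    | C_mul_T k s =>
      rw [mul_assoc, ← T_add, coeff_C_mul_T, coeff_C_mul_T]
      simp only [eq_sub_iff_add_eq]
  sum_coeff b := by
    obtain ⟨p, rfl⟩ := op_surjective b
    have hT : ∀ n : ℤ, (((⟨op (T 1), op (T (-1)), by rw [← op_mul, ← T_add]; simp,
        by rw [← op_mul, ← T_add]; simp⟩ : ((LaurentPolynomial R)ᵐᵒᵖ)ˣ) ^ n :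
        ((LaurentPolynomial R)ᵐᵒᵖ)ˣ) : (LaurentPolynomial R)ᵐᵒᵖ) = op (T n) := fun n => by
      obtain ⟨j, rfl | rfl⟩ := n.eq_nat_or_neg
      · rw [zpow_natCast, Units.val_pow_eq_pow_val]
        simp [← op_pow]
      · rw [zpow_neg, ← inv_zpow, zpow_natCast, Units.val_pow_eq_pow_val, Units.inv_mk]
        simp [← op_pow]
    rw [AddMonoidHom.mk'_apply, Finsupp.sum_mapRange_index (by simp)]
    conv_rhs => rw [← AddMonoidAlgebra.sum_coeff_single p]
    rw [unop_op, Finsupp.sum, Finsupp.sum, Finset.op_sum]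
    refine Finset.sum_congr rfl fun n _ => ?_
    rw [hT, single_eq_C_mul_T, ← (commute_T n _).eq, op_mul]
    rfl

theorem coeff_inclPlus (p : Polynomial R) (n : ℤ) (hn : n < 0) : (inclPlus R p).coeff n = 0 := by
  induction p using Polynomial.induction_on' with
  | add p q hp hq => rw [map_add, AddMonoidAlgebra.coeff_add, Finsupp.add_apply, hp, hq, add_zero]
  | monomial k a =>
    rw [inclPlus, Polynomial.toLaurent_C_mul_T, coeff_C_mul_T, if_neg (by omega)]

theorem inclMinus_monomial (k : ℕ) (a : R) :
    inclMinus R (Polynomial.monomial k a) = LaurentPolynomial.C a * T (-k) := by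
  change Polynomial.eval₂ _ _ _ = _
  rw [Polynomial.eval₂_monomial, T_pow, mul_neg_one]

theorem coeff_inclMinus (p : Polynomial R) (n : ℤ) (hn : 0 < n) : (inclMinus R p).coeff n = 0 := by
  induction p using Polynomial.induction_on' with
  | add p q hp hq => rw [map_add, AddMonoidAlgebra.coeff_add, Finsupp.add_apply, hp, hq, add_zero]
  | monomial k a => rw [inclMinus_monomial, coeff_C_mul_T, if_neg (by omega)]

end ConcreteLaurent

/-! ### Dual bases under extension of scalars, and lattices from charts. -/

section DualBases

variable {A' B : Type u} [Ring A'] [Ring B]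

/-- A morphism to a restriction of scalars, as a semilinear map. -/
def semilinearOfRestrict (f : A' →+* B) {M' : ModuleCat.{u} A'} {M : ModuleCat.{u} B}
    (μ : M' ⟶ (ModuleCat.restrictScalars f).obj M) : M' →ₛₗ[f] M where
  toFun x := μ.hom x
  map_add' := μ.hom.map_add
  map_smul' := μ.hom.map_smul

theorem extLift_tmul' (f : A' →+* B) {M' : ModuleCat.{u} A'} {M : ModuleCat.{u} B}
    (μ : M' ⟶ (ModuleCat.restrictScalars f).obj M) (b : B) (x : M') :
    (extLift f M' M μ).hom (extTmul f M' b x) = b • semilinearOfRestrict f μ x := rfl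

/-- Dual bases of finitely generated projective modules can be extended along a ring
homomorphism. -/
theorem exists_dualBasis_of_isIso_extLift (f : A' →+* B) {M' : ModuleCat.{u} A'}
    {M : ModuleCat.{u} B} (μ : M' ⟶ (ModuleCat.restrictScalars f).obj M)
    (hμ : IsIso (extLift f M' M μ)) (h : Module.Finite A' M' ∧ Module.Projective A' M') :
    ∃ (k : ℕ) (m : Fin k → M') (ψ : Fin k → M →ₗ[B] B),
      (∀ i x, ψ i (semilinearOfRestrict f μ x) ∈ f.range) ∧
      ∀ x, ∑ i, ψ i x • semilinearOfRestrict f μ (m i) = x := by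
  obtain ⟨h₁, h₂⟩ := h
  obtain ⟨k, π, s, -, -, hs⟩ := Module.Finite.exists_comp_eq_id_of_projective A' M'
  let g : Fin k → (M' ⟶ (ModuleCat.restrictScalars f).obj (ModuleCat.of B B)) := fun i =>
    ModuleCat.ofHom (Y := (ModuleCat.restrictScalars f).obj (ModuleCat.of B B))
      { toFun := fun x => f (s x i)
        map_add' := fun x y => by
          rw [map_add, Pi.add_apply, map_add]
          rfl
        map_smul' := fun a x => by
          rw [map_smul, Pi.smul_apply, smul_eq_mul, map_mul]
          rfl }
  let e := inv (extLift f M' M μ)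
  -- The coordinate functions of M', extended `B`-linearly to B ⊗ M' and transported to `M` by the
  -- inverse of the adjoint map.
  let ψ : Fin k → M →ₗ[B] B := fun i => (e ≫ extLift f M' (ModuleCat.of B B) (g i)).hom
  have hψ : ∀ i x, ψ i (semilinearOfRestrict f μ x) = f (s x i) := fun i x => by
    have h₁ : (extLift f M' M μ).hom (extTmul f M' 1 x) = semilinearOfRestrict f μ x :=
      one_smul B (semilinearOfRestrict f μ x)
    change (extLift f M' (ModuleCat.of B B) (g i)).hom (e.hom _) = _
    rw [← h₁]
    have h₂ : e.hom ((extLift f M' M μ).hom (extTmul f M' 1 x)) = extTmul f M' 1 x := by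
      change (extLift f M' M μ ≫ inv (extLift f M' M μ)).hom _ = _
      rw [IsIso.hom_inv_id]
      rfl
    rw [h₂]
    exact one_mul (f (s x i))
  refine ⟨k, fun i => π (Pi.single i 1), ψ, fun i x => ⟨_, (hψ i x).symm⟩, fun x => ?_⟩
  obtain ⟨z, rfl⟩ : ∃ z, (extLift f M' M μ).hom z = x := by
    refine ⟨e.hom x, ?_⟩
    change (inv (extLift f M' M μ) ≫ extLift f M' M μ).hom _ = _
    rw [IsIso.inv_hom_id]
    rfl
  induction z using ext_induction with
  | tmul b x =>
    rw [extLift_tmul']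
    simp only [map_smul, hψ, smul_assoc]
    rw [← Finset.smul_sum]
    congr 1
    have hx : ∑ i, s x i • π (Pi.single i 1) = x := by
      refine Eq.trans ?_ (LinearMap.congr_fun hs x)
      rw [LinearMap.comp_apply]
      conv_rhs => rw [← Finset.univ_sum_single (s x), map_sum]
      refine Finset.sum_congr rfl fun i _ => ?_
      rw [← map_smul, ← Pi.single_smul, smul_eq_mul, mul_one]
    conv_rhs => rw [← hx]
    rw [map_sum]
    exact Finset.sum_congr rfl fun i _ => (map_smulₛₗ _ _ _).symm
  | add x y hx hy =>
    simp only [map_add, add_smul, Finset.sum_add_distrib]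
    rw [hx, hy]

/-- The lattice is the image of M' in `M`. The hypotheses on `f` say that its range contains the
constants and t, and involves no negative powers of t. -/
theorem LaurentRing.exists_latticeBasis {A : Type u} [Ring A] (D : LaurentRing A B)
    (f : A' →+* B) (hf : ∀ a, ∀ n < 0, D.coeff (f a) n = 0) (hc : ∀ a, D.c a ∈ f.range)
    (ht : (D.t : B) ∈ f.range) {M' : ModuleCat.{u} A'} {M : ModuleCat.{u} B} [Module A M]
    (hM : ∀ (a : A) (x : M), a • x = D.c a • x)
    (μ : M' ⟶ (ModuleCat.restrictScalars f).obj M) (hμ : IsIso (extLift f M' M μ))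
    (h : Module.Finite A' M' ∧ Module.Projective A' M') :
    ∃ P : Submodule A M, Nonempty (D.LatticeBasis P) := by
  obtain ⟨k, m, ψ, hψ, hsum⟩ := exists_dualBasis_of_isIso_extLift f μ hμ h
  let P : Submodule A M :=
    { carrier := {y | ∃ x, semilinearOfRestrict f μ x = y}
      zero_mem' := ⟨0, map_zero _⟩
      add_mem' := by
        rintro _ _ ⟨x, rfl⟩ ⟨y, rfl⟩
        exact ⟨x + y, map_add _ x y⟩
      smul_mem' := by
        rintro a _ ⟨x, rfl⟩
        obtain ⟨a', ha'⟩ := hc a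
        exact ⟨a' • x, by rw [hM, ← ha', map_smulₛₗ]⟩ }
  refine ⟨P, ⟨⟨k, fun i => semilinearOfRestrict f μ (m i), ψ, ?_, fun i => ⟨m i, rfl⟩, ?_, hsum⟩⟩⟩
  · rintro _ ⟨x, rfl⟩
    obtain ⟨a', ha'⟩ := ht
    exact ⟨a' • x, by rw [← ha', map_smulₛₗ]⟩
  · rintro i _ ⟨x, rfl⟩ n hn
    obtain ⟨a', ha'⟩ := hψ i x
    rw [← ha']
    exact hf a' n hn

end DualBases

/-! ### Restricting bundles to the torus: (1) ⇒ (3) ⇒ (2). -/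

section Torus

variable {R : Type u} [Ring R]

open MulOpposite LaurentPolynomial

/-- The class of the restriction of a vector bundle to the torus is extended from `R`. -/
theorem P1Sheaf.isVectorBundle.cls_torus_mem {V : P1Sheaf R} (hV : isVectorBundle R V) :
    (K0Group.cls V.torus hV.2.1 : K0 (LaurentPolynomial R)) ∈ (pStar R).range := by
  let D := laurentOp R
  -- Both lattices are submodules over the constants, which is where they can be intersected.
  let _ : Module Rᵐᵒᵖ V.torus := Module.compHom V.torus D.c
  have hM : ∀ (a : Rᵐᵒᵖ) (x : V.torus), a • x = D.c a • x := fun _ _ => rfl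
  obtain ⟨P, ⟨β⟩⟩ := D.exists_latticeBasis (inclPlus R).op
    (fun a n hn => congrArg op (coeff_inclPlus R (unop a) n hn))
    (fun a => ⟨op (Polynomial.C (unop a)), congrArg op (Polynomial.toLaurent_C (unop a))⟩)
    ⟨op Polynomial.X, congrArg op Polynomial.toLaurent_X⟩ hM V.muPlus V.isIso_plus hV.2.2
  obtain ⟨N, ⟨γ⟩⟩ := D.symm.exists_latticeBasis (inclMinus R).op
    (fun a n hn => by
      rw [D.symm_coeff]
      exact congrArg op (coeff_inclMinus R (unop a) (-n) (by omega)))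
    (fun a => ⟨op (Polynomial.C (unop a)), congrArg op
      ((inclMinus_monomial R 0 (unop a)).trans (by simp))⟩)
    ⟨op Polynomial.X, congrArg op ((inclMinus_monomial R 1 1).trans (by simp))⟩
    hM V.muMinus V.isIso_minus hV.1
  obtain ⟨H', H, ι, π, w, hH', hH, hS⟩ := LaurentRing.exists_resolution hM β γ
  have h := K0Group.cls_add_cls (P := fgProj (LaurentPolynomial R)) (E := fun E => E.ShortExact)
    (ShortComplex.mk ι π w) hS (fgProj_rExt LaurentPolynomial.C H' hH')
    (fgProj_rExt LaurentPolynomial.C H hH) hV.2.1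
  have h' : (K0Group.cls V.torus hV.2.1 : K0 (LaurentPolynomial R)) =
      pStar R (K0Group.cls H hH) - pStar R (K0Group.cls H' hH') :=
    eq_sub_of_add_eq' h.symm
  rw [h', ← map_sub]
  exact ⟨_, rfl⟩

theorem iStar_range_le : (iStar R).range ≤ (pStar R).range := by
  rintro _ ⟨z, rfl⟩
  exact K0Group.mem_of_cls_mem ((pStar R).range.comap (iStar R))
    (fun X hX => hX.cls_torus_mem) z

theorem ExtendsToP1.K0Class_mem {C : ChainComplex (RMod (LaurentPolynomial R)) ℤ}
    (hC : IsStrictPerfect C) (h : ExtendsToP1 C) : hC.K0Class ∈ (iStar R).range := by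
  obtain ⟨V, hV, hq⟩ := h
  have hV' : IsStrictPerfect
      ((P1Sheaf.resTorus.mapHomologicalComplex (ComplexShape.down ℤ)).obj V) := by
    obtain ⟨a, b, hab⟩ := hV.bounded
    exact ⟨⟨a, b, fun n hn => P1Sheaf.resTorus.map_isZero (hab n hn)⟩,
      fun n => (hV.isVectorBundle n).2.1⟩
  rw [← AreQuasiIso.K0Class_eq hV' hC hq, IsStrictPerfect.K0Class]
  refine finsum_induction (p := fun z => z ∈ (iStar R).range) (zero_mem _)
    (fun _ _ => add_mem) fun n => zsmul_mem ?_ _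
  exact ⟨K0Group.cls (V.X n) (hV.isVectorBundle n), K0Group.map_cls _ _ _ _ _⟩

end Torus

/-! ### Lattices in modules extended from the constants. -/

section ExtendedModules

variable {A A' B : Type u} [Ring A] [Ring A'] [Ring B]

/-- A dual basis which restricts to one over the subring of constants: it exhibits a `B`-module
as being extended from `A`. -/
structure ExtendedBasis (c : A →+* B) (M : ModuleCat.{u} B) where
  k : ℕ
  m : Fin k → M
  ψ : Fin k → M →ₗ[B] B
  mem_range : ∀ i j, ψ i (m j) ∈ c.range
  sum_smul : ∀ x, ∑ i, ψ i x • m i = x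

/-- A dual basis of `P` extends to one of `M`; the coordinates of its generators are computed in
`P`, hence are constants. -/
theorem nonempty_extendedBasis (c : A →+* B) {P : ModuleCat.{u} A} {M : ModuleCat.{u} B}
    (hP : Module.Finite A P ∧ Module.Projective A P) (e : extObj c P ≅ M) :
    Nonempty (ExtendedBasis c M) := by
  have he : extLift c P M (extUnit c P ≫ (ModuleCat.restrictScalars c).map e.hom) = e.hom :=
    (extHomEquiv c P M).symm_apply_apply e.hom
  obtain ⟨k, m, ψ, hψ, hsum⟩ := exists_dualBasis_of_isIso_extLift c
    (extUnit c P ≫ (ModuleCat.restrictScalars c).map e.hom) (by rw [he]; infer_instance) hP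
  exact ⟨⟨k, _, ψ, fun i j => hψ i (m j), hsum⟩⟩

/-- A module with compatible dual bases before and after extension of scalars. -/
theorem isIso_extLift_of_dualBasis (f : A' →+* B) {M' : ModuleCat.{u} A'} {M : ModuleCat.{u} B}
    (μ : M' ⟶ (ModuleCat.restrictScalars f).obj M) {k : ℕ} (m : Fin k → M')
    (φ : Fin k → M' →ₗ[A'] A') (ψ : Fin k → M →ₗ[B] B)
    (h : ∀ i x, ψ i (semilinearOfRestrict f μ x) = f (φ i x))
    (hφ : ∀ x, ∑ i, φ i x • m i = x)
    (hψ : ∀ x, ∑ i, ψ i x • semilinearOfRestrict f μ (m i) = x) :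
    IsIso (extLift f M' M μ) := by
  -- The inverse is x ↦ ∑ ψᵢ(x) ⊗ mᵢ.
  let g : M ⟶ extObj f M' := ModuleCat.ofHom
    (∑ i, LinearMap.toSpanSingleton B (extObj f M') (extTmul f M' 1 (m i)) ∘ₗ ψ i)
  have hg : ∀ x, g.hom x = ∑ i, extTmul f M' (ψ i x) (m i) := fun x => by
    change (∑ i, LinearMap.toSpanSingleton B (extObj f M') (extTmul f M' 1 (m i)) ∘ₗ ψ i) x = _
    rw [LinearMap.sum_apply]
    refine Finset.sum_congr rfl fun i _ => ?_
    rw [LinearMap.comp_apply, LinearMap.toSpanSingleton_apply, extTmul_smul, mul_one]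
  refine ⟨g, ?_, ?_⟩
  · ext z
    change g.hom ((extLift f M' M μ).hom z) = z
    induction z using ext_induction with
    | tmul b x =>
      rw [extLift_tmul', hg]
      conv_rhs => rw [← hφ x]
      change _ = extTmulRight f M' b _
      rw [map_sum]
      refine Finset.sum_congr rfl fun i _ => ?_
      rw [map_smul, h, smul_eq_mul, extTmul_balanced]
      rfl
    | add x y hx hy => rw [map_add, map_add, hx, hy]
  · ext x
    change (extLift f M' M μ).hom (g.hom x) = x
    rw [hg, map_sum]
    exact hψ x

theorem finite_projective_of_dualBasis {M' : Type u} [AddCommGroup M'] [Module A' M'] {k : ℕ}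
    (m : Fin k → M') (φ : Fin k → M' →ₗ[A'] A') (hφ : ∀ x, ∑ i, φ i x • m i = x) :
    Module.Finite A' M' ∧ Module.Projective A' M' := by
  have h : (Fintype.linearCombination A' m) ∘ₗ LinearMap.pi φ = LinearMap.id :=
    LinearMap.ext fun x => hφ x
  exact ⟨Module.Finite.of_surjective (Fintype.linearCombination A' m)
    fun x => ⟨_, LinearMap.congr_fun h x⟩, Module.Projective.of_split _ _ h⟩

namespace LaurentRing

variable (D : LaurentRing A B)

/-- A ring homomorphism which identifies `A'` with the subring `A[t]` of `A[t, t⁻¹]`. -/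
structure IsChart (f : A' →+* B) : Prop where
  coeff : ∀ a, ∀ n < 0, D.coeff (f a) n = 0
  c_mem : ∀ a, D.c a ∈ f.range
  t_mem : (D.t : B) ∈ f.range
  injective : Function.Injective f

variable {D}

theorem IsChart.mem_range {f : A' →+* B} (hf : D.IsChart f) {b : B}
    (h : ∀ n < 0, D.coeff b n = 0) : b ∈ f.range := by
  rw [← D.sum_coeff b]
  refine sum_mem fun n hn => mul_mem (hf.c_mem _) ?_
  have hn' : 0 ≤ n := by
    by_contra hlt
    exact Finsupp.mem_support_iff.1 hn (h n (not_le.1 hlt))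
  lift n to ℕ using hn'
  rw [zpow_natCast, Units.val_pow_eq_pow_val]
  exact pow_mem hf.t_mem n

/-- Lower bounds for the degrees of a product. -/
theorem coeff_mul_eq_zero_of_lt {b b' : B} {k l : ℤ} (h : ∀ n < k, D.coeff b n = 0)
    (h' : ∀ n < l, D.coeff b' n = 0) (n : ℤ) (hn : n < k + l) : D.coeff (b * b') n = 0 := by
  have := D.symm.coeff_mul_eq_zero (b := b) (b' := b') (k := -k) (l := -l)
    (fun n hn => (D.symm_coeff b n).trans (h _ (by omega)))
    (fun n hn => (D.symm_coeff b' n).trans (h' _ (by omega))) (-n) (by omega)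
  rwa [D.symm_coeff, neg_neg] at this

/-- The condition that the coordinates of `x` lie in `t^e A[t]`. -/
def InLattice (D : LaurentRing A B) {c : A →+* B} {M : ModuleCat.{u} B}
    (β : ExtendedBasis c M) (e : ℤ) (x : M) : Prop :=
  ∀ i, ∀ n < e, D.coeff (β.ψ i x) n = 0

theorem InLattice.zero {c : A →+* B} {M : ModuleCat.{u} B} (β : ExtendedBasis c M) (e : ℤ) :
    InLattice D β e 0 := fun i n _ => by simp

theorem InLattice.add {c : A →+* B} {M : ModuleCat.{u} B} {β : ExtendedBasis c M} {e : ℤ}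
    {x y : M} (hx : InLattice D β e x) (hy : InLattice D β e y) : InLattice D β e (x + y) :=
  fun i n hn => by
    rw [map_add, map_add, Finsupp.add_apply, hx i n hn, hy i n hn, add_zero]

theorem InLattice.smul {f : A' →+* B} (hf : D.IsChart f) {c : A →+* B} {M : ModuleCat.{u} B}
    {β : ExtendedBasis c M} {e : ℤ} {x : M} (a : A') (hx : InLattice D β e x) :
    InLattice D β e (f a • x) := fun i n hn => by
  rw [map_smul, smul_eq_mul]
  exact coeff_mul_eq_zero_of_lt (hf.coeff a) (hx i) n (by omega)

/-- The lattice `t^e A[t] ⊗ M₀` in the module `M = A[t, t⁻¹] ⊗ M₀`. -/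
def extendedLattice {f : A' →+* B} (hf : D.IsChart f) {M : ModuleCat.{u} B}
    (β : ExtendedBasis D.c M) (e : ℤ) :
    Submodule A' ((ModuleCat.restrictScalars f).obj M) where
  carrier := {x | InLattice D β e x}
  zero_mem' := InLattice.zero β e
  add_mem' := InLattice.add
  smul_mem' a _ := InLattice.smul hf a

/-- The inclusion of the lattice. -/
def extendedLatticeι {f : A' →+* B} (hf : D.IsChart f) {M : ModuleCat.{u} B}
    (β : ExtendedBasis D.c M) (e : ℤ) :
    ModuleCat.of A' (extendedLattice hf β e) ⟶ (ModuleCat.restrictScalars f).obj M :=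
  ModuleCat.ofHom (Y := (ModuleCat.restrictScalars f).obj M) (extendedLattice hf β e).subtype

/-- The rescaled dual basis tᵉmⱼ, t⁻ᵉψᵢ of `M` restricts to the lattice. Each tᵉmⱼ lies in it
because the ψᵢ(mⱼ) are constants; on it the functions t⁻ᵉψᵢ have no negative powers of t, so they
take values in the image of A'. -/
theorem extendedLattice_spec {f : A' →+* B} (hf : D.IsChart f) {M : ModuleCat.{u} B}
    (β : ExtendedBasis D.c M) (e : ℤ) :
    (Module.Finite A' (extendedLattice hf β e) ∧ Module.Projective A' (extendedLattice hf β e)) ∧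
      IsIso (extLift f _ M (extendedLatticeι hf β e)) := by
  have htt : ((D.t ^ (-e) : Bˣ) : B) * ((D.t ^ e : Bˣ) : B) = 1 := by
    rw [← Units.val_mul, ← zpow_add, neg_add_cancel, zpow_zero, Units.val_one]
  let ψ : Fin β.k → M →ₗ[B] B := fun i =>
    LinearMap.toSpanSingleton B B ((D.t ^ (-e) : Bˣ) : B) ∘ₗ β.ψ i
  have hψ : ∀ i x, ψ i x = β.ψ i x * ((D.t ^ (-e) : Bˣ) : B) := fun i x => rfl
  let m : Fin β.k → extendedLattice hf β e := fun j => ⟨((D.t ^ e : Bˣ) : B) • β.m j, by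
    intro i n hn
    obtain ⟨a, ha⟩ := β.mem_range i j
    rw [map_smul, smul_eq_mul, ← ha, D.coeff_t_zpow_mul, ← mul_one (D.c a), D.coeff_c_mul,
      D.coeff_one, Finsupp.single_apply, if_neg (by omega), mul_zero]⟩
  have hm : ∀ j, semilinearOfRestrict f (extendedLatticeι hf β e) (m j) =
      ((D.t ^ e : Bˣ) : B) • β.m j := fun j => rfl
  have hsum : ∀ x : M, ∑ i, ψ i x • (((D.t ^ e : Bˣ) : B) • β.m i) = x := fun x => by
    conv_rhs => rw [← β.sum_smul x]
    refine Finset.sum_congr rfl fun i _ => ?_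
    rw [hψ, ← mul_smul, mul_assoc, htt, mul_one]
  have hmem : ∀ i (x : extendedLattice hf β e), ∃ a, f a =
      ψ i (semilinearOfRestrict f (extendedLatticeι hf β e) x) := fun i x => by
    refine hf.mem_range fun n hn => ?_
    rw [hψ, ← D.t_zpow_comm, D.coeff_t_zpow_mul]
    exact (show InLattice D β e (semilinearOfRestrict f (extendedLatticeι hf β e) x) from x.2) i _
      (by omega)
  choose φ hφ using hmem
  -- The values were chosen pointwise; injectivity of `f` makes them unique and therefore linear.
  let φ' : Fin β.k → extendedLattice hf β e →ₗ[A'] A' := fun i =>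
    { toFun := φ i
      map_add' := fun x y => hf.injective (by
        rw [map_add, hφ, hφ, hφ, map_add, map_add])
      map_smul' := fun a x => hf.injective (by
        rw [RingHom.id_apply, smul_eq_mul, map_mul, hφ, hφ, map_smulₛₗ, map_smul, smul_eq_mul]) }
  have hφsum : ∀ x, ∑ i, φ' i x • m i = x := fun x => by
    have hinj : Function.Injective (semilinearOfRestrict f (extendedLatticeι hf β e)) :=
      Subtype.val_injective
    refine hinj ?_
    rw [map_sum, ← hsum (semilinearOfRestrict f (extendedLatticeι hf β e) x)]
    refine Finset.sum_congr rfl fun i _ => ?_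
    rw [map_smulₛₗ, hm, ← hφ i x]
    rfl
  refine ⟨finite_projective_of_dualBasis m φ' hφsum, ?_⟩
  exact isIso_extLift_of_dualBasis f (extendedLatticeι hf β e) m φ' ψ
    (fun i x => (hφ i x).symm) hφsum (fun x => by simpa only [hm] using hsum x)

/-- A homomorphism whose matrix has degrees bounded by `δ` maps lattices to lattices. -/
theorem map_mem_extendedLattice {c : A →+* B} {M N : ModuleCat.{u} B}
    {β : ExtendedBasis c M} {γ : ExtendedBasis c N} {u : M ⟶ N} {δ e e' : ℤ}
    (h : ∀ i j, ∀ n < -δ, D.coeff (γ.ψ i (u.hom (β.m j))) n = 0) (he : e' ≤ e - δ) {x : M}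
    (hx : InLattice D β e x) : InLattice D γ e' (u.hom x) := by
  intro i n hn
  rw [← β.sum_smul x, map_sum, map_sum, map_sum, Finsupp.finsetSum_apply]
  refine Finset.sum_eq_zero fun j _ => ?_
  rw [map_smul, map_smul, smul_eq_mul]
  exact coeff_mul_eq_zero_of_lt (hx j) (h i j) n (by omega)

end LaurentRing

end ExtendedModules

/-! ### The two affine lines as charts. -/

section Charts

open MulOpposite LaurentPolynomial

variable (R : Type u) [Ring R]

theorem isChart_inclPlus : (laurentOp R).IsChart (inclPlus R).op where
  coeff a n hn := congrArg op (coeff_inclPlus R (unop a) n hn)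
  c_mem a := ⟨op (Polynomial.C (unop a)), congrArg op (Polynomial.toLaurent_C (unop a))⟩
  t_mem := ⟨op Polynomial.X, congrArg op Polynomial.toLaurent_X⟩
  injective _ _ h := unop_injective (Polynomial.toLaurent_injective (op_injective h))

theorem coeff_inclMinus_neg (p : Polynomial R) (k : ℕ) :
    (inclMinus R p).coeff (-k) = p.coeff k := by
  induction p using Polynomial.induction_on' with
  | add p q hp hq =>
    rw [map_add, AddMonoidAlgebra.coeff_add, Finsupp.add_apply, hp, hq, Polynomial.coeff_add]
  | monomial l a =>
    rw [inclMinus_monomial, coeff_C_mul_T, Polynomial.coeff_monomial]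
    simp

theorem isChart_inclMinus : (laurentOp R).symm.IsChart (inclMinus R).op where
  coeff a n hn := by
    rw [LaurentRing.symm_coeff]
    exact congrArg op (coeff_inclMinus R (unop a) (-n) (by omega))
  c_mem a := ⟨op (Polynomial.C (unop a)), congrArg op
    ((inclMinus_monomial R 0 (unop a)).trans (by simp))⟩
  t_mem := ⟨op Polynomial.X, congrArg op ((inclMinus_monomial R 1 1).trans (by simp))⟩
  injective _ _ h := unop_injective (Polynomial.ext fun k => by
    rw [← coeff_inclMinus_neg, ← coeff_inclMinus_neg]
    exact congrArg (fun p : LaurentPolynomial R => p.coeff (-k)) (op_injective h))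

end Charts

/-! ### Complexes of extended modules extend to the projective line. -/

section ExtensionToP1

open LaurentRing

variable {R : Type u} [Ring R]

/-- The vector bundle `M₀ ⊗ 𝒪` twisted symmetrically by `e`. -/
def extendedSheaf {M : RMod (LaurentPolynomial R)} (β : ExtendedBasis (laurentOp R).c M) (e : ℤ) :
    P1Sheaf R where
  minus := ModuleCat.of _ (extendedLattice (isChart_inclMinus R) β e)
  torus := M
  plus := ModuleCat.of _ (extendedLattice (isChart_inclPlus R) β e)
  muMinus := extendedLatticeι (isChart_inclMinus R) β e
  muPlus := extendedLatticeι (isChart_inclPlus R) β e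
  isIso_minus := (extendedLattice_spec (isChart_inclMinus R) β e).2
  isIso_plus := (extendedLattice_spec (isChart_inclPlus R) β e).2

theorem isVectorBundle_extendedSheaf {M : RMod (LaurentPolynomial R)}
    (hM : fgProj _ M) (β : ExtendedBasis (laurentOp R).c M) (e : ℤ) :
    P1Sheaf.isVectorBundle R (extendedSheaf β e) :=
  ⟨(extendedLattice_spec (isChart_inclMinus R) β e).1, hM,
    (extendedLattice_spec (isChart_inclPlus R) β e).1⟩

/-- The morphism induced by a homomorphism which respects the lattices. -/
def extendedSheafMap {M N : RMod (LaurentPolynomial R)} (β : ExtendedBasis (laurentOp R).c M)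
    (γ : ExtendedBasis (laurentOp R).c N) (e e' : ℤ) (u : M ⟶ N)
    (h₁ : ∀ x ∈ extendedLattice (isChart_inclMinus R) β e,
      u.hom x ∈ extendedLattice (isChart_inclMinus R) γ e')
    (h₂ : ∀ x ∈ extendedLattice (isChart_inclPlus R) β e,
      u.hom x ∈ extendedLattice (isChart_inclPlus R) γ e') :
    extendedSheaf β e ⟶ extendedSheaf γ e' :=
  (⟨ModuleCat.ofHom (((rRes (inclMinus R)).map u).hom.restrict h₁), u,
    ModuleCat.ofHom (((rRes (inclPlus R)).map u).hom.restrict h₂),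
    by ext x; rfl, by ext x; rfl⟩ : P1Sheaf.Hom _ _)

/-- The complex of sheaves with constituents `M₀ ⊗ 𝒪(2 e n)` in degree `n`. -/
def extendedComplex (C : ChainComplex (RMod (LaurentPolynomial R)) ℤ)
    (β : ∀ n, ExtendedBasis (laurentOp R).c (C.X n)) (e : ℤ → ℤ)
    (h₁ : ∀ i j, ∀ x ∈ extendedLattice (isChart_inclMinus R) (β i) (e i),
      (C.d i j).hom x ∈ extendedLattice (isChart_inclMinus R) (β j) (e j))
    (h₂ : ∀ i j, ∀ x ∈ extendedLattice (isChart_inclPlus R) (β i) (e i),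
      (C.d i j).hom x ∈ extendedLattice (isChart_inclPlus R) (β j) (e j)) :
    ChainComplex (P1Sheaf R) ℤ where
  X n := extendedSheaf (β n) (e n)
  d i j := extendedSheafMap (β i) (β j) (e i) (e j) (C.d i j) (h₁ i j) (h₂ i j)
  shape i j hij := by
    have h := C.shape i j hij
    refine P1Sheaf.hom_ext ?_ h ?_ <;>
    · ext x
      exact Subtype.ext congr($h x.1)
  d_comp_d' i j k _ _ := by
    have h := C.d_comp_d i j k
    refine P1Sheaf.hom_ext ?_ h ?_ <;>
    · ext x
      exact Subtype.ext congr($h x.1)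

/-- A bounded complex of modules extended from `R` extends to the projective line. -/
theorem extendsToP1_of_extendedBasis {C : ChainComplex (RMod (LaurentPolynomial R)) ℤ}
    (hC : IsStrictPerfect C) (β : ∀ n, ExtendedBasis (laurentOp R).c (C.X n)) :
    ExtendsToP1 C := by
  obtain ⟨a, b, hab⟩ := hC.bounded
  have hbound : ∀ n, ∃ k : ℕ, ∀ i j, ∀ l : ℤ, (k : ℤ) < |l| →
      (laurentOp R).coeff ((β (n - 1)).ψ i ((C.d n (n - 1)).hom ((β n).m j))) l = 0 := fun n => by
    obtain ⟨k, hk⟩ := (laurentOp R).exists_coeff_bound_family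
      fun p : Fin (β (n - 1)).k × Fin (β n).k =>
        (β (n - 1)).ψ p.1 ((C.d n (n - 1)).hom ((β n).m p.2))
    exact ⟨k, fun i j => hk (i, j)⟩
  choose k hk using hbound
  -- One bound serves all degrees: outside [a, b] the source of the differential is zero.
  let δ : ℕ := (Finset.Icc a b).sup k
  have hδ : ∀ n i j, ∀ l : ℤ, (δ : ℤ) < |l| →
      (laurentOp R).coeff ((β (n - 1)).ψ i ((C.d n (n - 1)).hom ((β n).m j))) l = 0 := by
    intro n i j l hl
    by_cases hn : n ∈ Finset.Icc a b
    · have := Finset.le_sup (f := k) hn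
      exact hk n i j l (lt_of_le_of_lt (by exact_mod_cast this) hl)
    · have h0 : C.d n (n - 1) = 0 := (hab n (by
        rw [Finset.mem_Icc] at hn
        omega)).eq_of_src _ _
      rw [h0]
      simp
  have hrel : ∀ i j, (C.d i j = 0) ∨ j = i - 1 := fun i j => by
    by_cases hij : (ComplexShape.down ℤ).Rel i j
    · right
      have : j + 1 = i := hij
      omega
    · exact Or.inl (C.shape i j hij)
  -- The differential lowers the degree n by one, so the exponent nδ drops by exactly δ, which
  -- absorbs powers up to t^δ and t^(-δ) of the differential on the two charts simultaneously.
  let V := extendedComplex C β (fun n => n * δ)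
    (fun i j x hx => by
      obtain h0 | rfl := hrel i j
      · rw [h0]
        exact Submodule.zero_mem _
      · refine map_mem_extendedLattice (D := (laurentOp R).symm) (δ := δ)
          (fun p q n hn => ?_) (by ring_nf; rfl) hx
        rw [symm_coeff]
        exact hδ i p q _ (lt_of_lt_of_le (by omega) (le_abs_self _)))
    (fun i j x hx => by
      obtain h0 | rfl := hrel i j
      · rw [h0]
        exact Submodule.zero_mem _
      · refine map_mem_extendedLattice (D := laurentOp R) (δ := δ)
          (fun p q n hn => ?_) (by ring_nf; rfl) hx
        exact hδ i p q _ (lt_of_lt_of_le (by omega) (neg_le_abs _)))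
  refine ⟨V, ⟨⟨a, b, fun n hn => ?_⟩, fun n => isVectorBundle_extendedSheaf (hC.fgProj n) _ _⟩, ?_⟩
  · have h0 := hab n hn
    have := ModuleCat.subsingleton_of_isZero h0
    rw [IsZero.iff_id_eq_zero]
    refine P1Sheaf.hom_ext ?_ (h0.eq_of_src _ _) ?_ <;>
    · ext x
      exact Subtype.ext (Subsingleton.elim (α := C.X n) _ _)
  · let e : (P1Sheaf.resTorus.mapHomologicalComplex (ComplexShape.down ℤ)).obj V ≅ C :=
      HomologicalComplex.Hom.isoOfComponents (fun n => Iso.refl (C.X n))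
        (fun i j _ => (Category.id_comp _).trans (Category.comp_id _).symm)
    exact Relation.EqvGen.rel _ _ ⟨e.hom, inferInstance⟩

end ExtensionToP1

/-! ### Modules extended from R, up to stabilisation. -/

section ExtendedObjects

variable {A B : Type u} [Ring A] [Ring B] (f : A →+* B)

/-- Modules isomorphic to the extension of scalars of a finitely generated projective module. -/
def IsExtended (M : RMod B) : Prop :=
  ∃ P : RMod A, fgProj A P ∧ Nonempty ((rExt f).obj P ≅ M)

variable {f}

theorem IsExtended.of_iso {M N : RMod B} (hM : IsExtended f M) (e : M ≅ N) : IsExtended f N := by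
  obtain ⟨P, hP, ⟨e'⟩⟩ := hM
  exact ⟨P, hP, ⟨e' ≪≫ e⟩⟩

theorem IsExtended.biprod {M N : RMod B} (hM : IsExtended f M) (hN : IsExtended f N) :
    IsExtended f (M ⊞ N) := by
  obtain ⟨P, hP, ⟨e⟩⟩ := hM
  obtain ⟨Q, hQ, ⟨e'⟩⟩ := hN
  have := preservesBinaryBiproducts_of_preservesBiproducts (rExt f)
  exact ⟨P ⊞ Q, fgProj_biprod hP hQ, ⟨(rExt f).mapBiprod P Q ≪≫ biprod.mapIso e e'⟩⟩

theorem isExtended_of_isZero {M : RMod B} (hM : IsZero M) : IsExtended f M :=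
  ⟨0, fgProj_of_isZero (isZero_zero _), ⟨((rExt f).map_isZero (isZero_zero _)).iso hM⟩⟩

theorem IsExtended.biprod_isZero {M N : RMod B} (hM : IsExtended f M) (hN : IsZero N) :
    IsExtended f (M ⊞ N) :=
  hM.biprod (isExtended_of_isZero hN)

theorem IsExtended.fgProj {M : RMod B} (hM : IsExtended f M) : fgProj B M := by
  obtain ⟨P, hP, ⟨e⟩⟩ := hM
  exact fgProj_of_iso e.symm (fgProj_rExt f P hP)

theorem IsExtended.cls_mem {M : RMod B} (hM : IsExtended f M) (h : _root_.fgProj B M) :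
    (K0Group.cls M h : K0 B) ∈ (K0.extend f).range := by
  obtain ⟨P, hP, ⟨e⟩⟩ := hM
  refine ⟨K0Group.cls P hP, (K0Group.map_cls _ _ _ _ _).trans ?_⟩
  exact K0Group.cls_eq_of_iso e _ h

variable (f) in
/-- Each finitely generated projective module is a direct summand of an extended one. -/
theorem exists_isExtended_biprod {M : RMod B} (hM : fgProj B M) :
    ∃ Q : RMod B, fgProj B Q ∧ IsExtended f (M ⊞ Q) := by
  obtain ⟨h₁, h₂⟩ := hM
  obtain ⟨n, π, hπ⟩ := Module.Finite.exists_fin' Bᵐᵒᵖ M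
  let P : RMod A := ModuleCat.of Aᵐᵒᵖ (ULift.{u} (Fin n) → Aᵐᵒᵖ)
  have hP : fgProj A P := ⟨inferInstanceAs (Module.Finite Aᵐᵒᵖ (ULift.{u} (Fin n) → Aᵐᵒᵖ)),
    inferInstanceAs (Module.Projective Aᵐᵒᵖ (ULift.{u} (Fin n) → Aᵐᵒᵖ))⟩
  let g : P ⟶ (rRes f).obj M := ModuleCat.ofHom (Y := (rRes f).obj M)
    (Fintype.linearCombination (M := (rRes f).obj M) Aᵐᵒᵖ fun i => π (Pi.single i.down 1))
  let q : (rExt f).obj P ⟶ M := extLift f.op P M g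
  have hq : Epi q := by
    refine (ModuleCat.epi_iff_surjective _).2 ?_
    rw [← LinearMap.range_eq_top, ← top_le_iff]
    intro x _
    obtain ⟨y, rfl⟩ := hπ x
    rw [← Finset.univ_sum_single y, map_sum]
    refine Submodule.sum_mem _ fun i _ => ?_
    have hy : Pi.single i (y i) = y i • (Pi.single i 1 : Fin n → Bᵐᵒᵖ) := by
      rw [← Pi.single_smul, smul_eq_mul, mul_one]
    rw [hy, map_smul]
    refine Submodule.smul_mem _ _ ⟨extTmul f.op P 1 (Pi.single ⟨i⟩ 1), ?_⟩
    refine (one_smul _ _).trans ?_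
    exact (Fintype.linearCombination_apply_single (M := (rRes f).obj M) Aᵐᵒᵖ _ _ _).trans
      (one_smul _ _)
  let S : ShortComplex (RMod B) := ShortComplex.mk (kernel.ι q) q (kernel.condition q)
  have hS : S.ShortExact := { exact := ShortComplex.exact_of_f_is_kernel _ (kernelIsKernel q) }
  have : Projective S.X₃ := fgProj.projective (M := M) ⟨h₁, h₂⟩
  have e : (rExt f).obj P ≅ kernel q ⊞ M := hS.splittingOfProjective.isoBinaryBiproduct
  exact ⟨kernel q, fgProj_of_iso_biprod e.symm (fgProj_rExt f P hP),
    P, hP, ⟨e ≪≫ biprod.braiding _ _⟩⟩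

/-- A module whose class is extended becomes extended after adding an extended module. -/
theorem exists_isExtended_isExtended_biprod {M : RMod B} (hM : fgProj B M)
    (h : (K0Group.cls M hM : K0 B) ∈ (K0.extend f).range) :
    ∃ Q : RMod B, IsExtended f Q ∧ IsExtended f (M ⊞ Q) := by
  obtain ⟨z, hz⟩ := h
  -- From [M] = [P ⊗ B] - [P' ⊗ B], the modules M ⊞ (P' ⊗ B) and P ⊗ B are stably isomorphic. The
  -- stabilising module `Z` need not be extended, so a complement `Z'` with Z ⊞ Z' extended is added
  -- too.
  obtain ⟨P, P', hP, hP', rfl⟩ := K0.exists_cls_sub_cls z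
  have hX := fgProj_rExt f P hP
  have hX' := fgProj_rExt f P' hP'
  have h₁ : (K0Group.cls (M ⊞ (rExt f).obj P') (fgProj_biprod hM hX') : K0 B) =
      K0Group.cls ((rExt f).obj P) hX := by
    rw [K0.cls_biprod hM hX', ← hz, map_sub]
    exact sub_add_cancel _ _
  obtain ⟨Z, hZ, ⟨e⟩⟩ := K0.exists_stable_iso _ _ h₁
  obtain ⟨Z', -, hZZ'⟩ := exists_isExtended_biprod f hZ
  have hPe : IsExtended f ((rExt f).obj P) := ⟨P, hP, ⟨Iso.refl _⟩⟩
  have hPe' : IsExtended f ((rExt f).obj P') := ⟨P', hP', ⟨Iso.refl _⟩⟩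
  refine ⟨(rExt f).obj P' ⊞ (Z ⊞ Z'), hPe'.biprod hZZ', (hPe.biprod hZZ').of_iso ?_⟩
  refine (biprod.associator _ _ _).symm ≪≫ biprod.mapIso ?_ (Iso.refl Z') ≪≫
    biprod.associator _ _ _ ≪≫ biprod.associator _ _ _
  exact biprod.braiding _ _ ≪≫ e.symm ≪≫ biprod.braiding _ _

end ExtendedObjects

/-! ### Adding contractible two-term complexes. -/

section Disks

open HomologicalComplex

variable {𝒜 : Type u} [Category.{v} 𝒜] [Abelian 𝒜]

/-- The contractible complex `Q = Q` in degrees `n + 1` and `n`. -/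
abbrev disk (Q : 𝒜) (n : ℤ) : ChainComplex 𝒜 ℤ :=
  double (𝟙 Q) (show (ComplexShape.down ℤ).Rel (n + 1) n from rfl)

theorem disk_acyclic (Q : 𝒜) (n : ℤ) : (disk Q n).Acyclic := by
  intro k
  have hd : IsIso ((disk Q n).d (n + 1) n) := by
    rw [double_d _ _ (by omega)]
    infer_instance
  by_cases h₁ : k = n + 1
  · subst h₁
    rw [exactAt_iff' _ (n + 1 + 1) (n + 1) n (by simp) (by simp)]
    refine (ShortComplex.exact_iff_mono _ ?_).2 (inferInstanceAs (Mono ((disk Q n).d (n + 1) n)))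
    have h₂ : IsZero ((disk Q n).X (n + 1 + 1)) := isZero_double_X _ _ _ (by omega) (by omega)
    exact h₂.eq_of_src _ _
  · by_cases h₀ : k = n
    · subst h₀
      rw [exactAt_iff' _ (k + 1) k (k - 1) (by simp) (by simp)]
      refine (ShortComplex.exact_iff_epi _ ?_).2 (inferInstanceAs (Epi ((disk Q k).d (k + 1) k)))
      have h₂ : IsZero ((disk Q k).X (k - 1)) := isZero_double_X _ _ _ (by omega) (by omega)
      exact h₂.eq_of_tgt _ _
    · have h₂ : IsZero ((disk Q n).X k) := isZero_double_X _ _ _ h₁ h₀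
      exact ShortComplex.exact_of_isZero_X₂ _ h₂

/-- On homology the first projection is inverse to the inclusion: the identity minus `biprod.fst ≫
biprod.inl` factors through the acyclic summand. -/
theorem quasiIso_biprod_inl {C D : ChainComplex 𝒜 ℤ} (hD : D.Acyclic) :
    QuasiIso (biprod.inl : C ⟶ C ⊞ D) where
  quasiIsoAt i := by
    rw [quasiIsoAt_iff_isIso_homologyMap]
    refine ⟨homologyMap biprod.fst i, ?_, ?_⟩
    · rw [← homologyMap_comp, biprod.inl_fst, homologyMap_id]
    · have h : (biprod.fst ≫ biprod.inl : C ⊞ D ⟶ C ⊞ D) = 𝟙 _ - biprod.snd ≫ biprod.inr := by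
        rw [eq_sub_iff_add_eq, biprod.total]
      have h0 : homologyMap (biprod.snd : C ⊞ D ⟶ D) i = 0 :=
        ((D.exactAt_iff_isZero_homology i).1 (hD i)).eq_of_tgt _ _
      rw [← homologyMap_comp, h, homologyMap_sub, homologyMap_comp, h0, zero_comp, homologyMap_id,
        sub_zero]

end Disks

section AddDisk

open HomologicalComplex

variable {S : Type u} [Ring S] (C : ChainComplex (RMod S) ℤ) (Q : RMod S) (n : ℤ)

/-- The degree `n` part of `C ⊞ disk Q n`. -/
def addDiskIso₀ : (C ⊞ disk Q n).X n ≅ C.X n ⊞ Q :=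
  biprodXIso C (disk Q n) n ≪≫ biprod.mapIso (Iso.refl _) (doubleXIso₁ _ _ (by omega))

/-- The degree `n + 1` part of `C ⊞ disk Q n`. -/
def addDiskIso₁ : (C ⊞ disk Q n).X (n + 1) ≅ C.X (n + 1) ⊞ Q :=
  biprodXIso C (disk Q n) (n + 1) ≪≫ biprod.mapIso (Iso.refl _) (doubleXIso₀ _ _)

variable {C Q}

theorem IsStrictPerfect.addDisk (hC : IsStrictPerfect C) (hQ : _root_.fgProj S Q) :
    IsStrictPerfect (C ⊞ disk Q n) where
  bounded := by
    obtain ⟨a, b, hab⟩ := hC.bounded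
    refine ⟨min a n, max b (n + 1), fun k hk => ?_⟩
    refine IsZero.of_iso ?_ (biprodXIso C (disk Q n) k)
    rw [biprod_isZero_iff]
    exact ⟨hab k (by omega), isZero_double_X _ _ _ (by omega) (by omega)⟩
  fgProj k := by
    by_cases h₁ : k = n + 1
    · subst h₁
      exact fgProj_of_iso (addDiskIso₁ C Q n) (fgProj_biprod (hC.fgProj _) hQ)
    · by_cases h₀ : k = n
      · subst h₀
        exact fgProj_of_iso (addDiskIso₀ C Q k) (fgProj_biprod (hC.fgProj _) hQ)
      · exact fgProj_of_iso (biprodXIso C (disk Q n) k) (fgProj_biprod (hC.fgProj _)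
          (fgProj_of_isZero (isZero_double_X _ _ _ h₁ h₀)))

variable (C Q)

theorem areQuasiIso_addDisk : AreQuasiIso C (C ⊞ disk Q n) :=
  Relation.EqvGen.rel _ _ ⟨biprod.inl, quasiIso_biprod_inl (disk_acyclic Q n)⟩

end AddDisk

/-! ### From an extended class to an extension of the complex: (2) ⇒ (1). -/

section Extension

open HomologicalComplex

variable {R : Type u} [Ring R]

theorem ExtendsToP1.of_areQuasiIso {C C' : ChainComplex (RMod (LaurentPolynomial R)) ℤ}
    (h : AreQuasiIso C C') (hC' : ExtendsToP1 C') : ExtendsToP1 C := by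
  obtain ⟨V, hV, hq⟩ := hC'
  exact ⟨V, hV, hq.trans _ _ _ (h.symm _ _)⟩

theorem extendsToP1_of_isExtended {C : ChainComplex (RMod (LaurentPolynomial R)) ℤ}
    (hC : IsStrictPerfect C)
    (h : ∀ n, IsExtended (LaurentPolynomial.C (R := R)) (C.X n)) : ExtendsToP1 C := by
  refine extendsToP1_of_extendedBasis hC fun n => Classical.choice ?_
  obtain ⟨P, hP, ⟨e⟩⟩ := h n
  exact nonempty_extendedBasis _ hP e

/-- If all terms but one are extended, and the class is, then so is the class of the
remaining term. -/
theorem cls_mem_of_K0Class_mem {C : ChainComplex (RMod (LaurentPolynomial R)) ℤ}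
    (hC : IsStrictPerfect C) (b : ℤ)
    (h : ∀ n ≠ b, IsExtended (LaurentPolynomial.C (R := R)) (C.X n))
    (hK : hC.K0Class ∈ (pStar R).range) :
    (K0Group.cls (C.X b) (hC.fgProj b) : K0 (LaurentPolynomial R)) ∈ (pStar R).range := by
  -- Modulo the image of `pStar` only the term in degree `b` survives, and its sign is invertible.
  let φ := QuotientAddGroup.mk' (pStar R).range
  have h₁ : φ hC.K0Class = φ ((b.negOnePow : ℤ) • K0Group.cls (C.X b) (hC.fgProj b)) := by
    rw [IsStrictPerfect.K0Class, AddMonoidHom.map_finsum φ hC.finite_support]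
    refine finsum_eq_single _ b fun n hn => ?_
    rw [QuotientAddGroup.mk'_apply, QuotientAddGroup.eq_zero_iff]
    exact zsmul_mem ((h n hn).cls_mem _) _
  have h₀ : φ hC.K0Class = 0 := (QuotientAddGroup.eq_zero_iff _).2 hK
  have h₂ := zsmul_mem ((QuotientAddGroup.eq_zero_iff _).1 (h₁.symm.trans h₀)) (b.negOnePow : ℤ)
  rwa [← mul_smul, ← Units.val_mul, Int.units_mul_self, Units.val_one, one_smul] at h₂

/-- Induction on the width `m` of the window [b - m, b] in which terms may fail to be extended. The
hypothesis on the class is used only when a single degree remains. -/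
theorem extendsToP1_of_K0Class_mem_aux (m : ℕ) (b : ℤ) :
    ∀ {C : ChainComplex (RMod (LaurentPolynomial R)) ℤ} (hC : IsStrictPerfect C),
      (∀ n, n < b - m ∨ b < n → IsExtended (LaurentPolynomial.C (R := R)) (C.X n)) →
      hC.K0Class ∈ (pStar R).range → ExtendsToP1 C := by
  induction m with
  | zero =>
    intro C hC h hK
    replace h : ∀ n ≠ b, IsExtended (LaurentPolynomial.C (R := R)) (C.X n) :=
      fun n hn => h n (by push_cast; omega)
    obtain ⟨Q, hQ, hCQ⟩ := exists_isExtended_isExtended_biprod (hC.fgProj b)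
      (cls_mem_of_K0Class_mem hC b h hK)
    -- The disk also adds `Q` in degree b + 1, so here `Q` itself has to be extended.
    refine ExtendsToP1.of_areQuasiIso (areQuasiIso_addDisk C Q b)
      (extendsToP1_of_isExtended (hC.addDisk b hQ.fgProj) fun n => ?_)
    by_cases h₁ : n = b + 1
    · subst h₁
      exact ((h _ (by omega)).biprod hQ).of_iso (addDiskIso₁ C Q b).symm
    · by_cases h₀ : n = b
      · subst h₀
        exact hCQ.of_iso (addDiskIso₀ C Q n).symm
      · exact ((h n h₀).biprod_isZero (isZero_double_X _ _ _ h₁ h₀)).of_iso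
          (biprodXIso C (disk Q b) n).symm
  | succ m ih =>
    intro C hC h hK
    let a := b - (m + 1 : ℕ)
    -- This repairs the bottom degree `a` of the window. The summand `Q` in degree a + 1 may fail to
    -- be extended, but that degree is still inside the smaller window.
    obtain ⟨Q, hQ, hCQ⟩ := exists_isExtended_biprod (LaurentPolynomial.C (R := R)) (hC.fgProj a)
    have hC' := hC.addDisk a hQ
    have hq := areQuasiIso_addDisk C Q a
    refine ExtendsToP1.of_areQuasiIso hq (ih hC' (fun n hn => ?_) (hq.K0Class_eq hC hC' ▸ hK))
    by_cases h₀ : n = a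
    · subst h₀
      exact hCQ.of_iso (addDiskIso₀ C Q a).symm
    · have h₁ : n < a ∨ b < n := by
        simp only [a] at h₀ ⊢
        push_cast at h₀ ⊢
        omega
      refine ((h n h₁).biprod_isZero (isZero_double_X _ _ _ ?_ h₀)).of_iso
        (biprodXIso C (disk Q a) n).symm
      simp only [a] at h₁ ⊢
      push_cast at h₁ ⊢
      omega

theorem extendsToP1_of_K0Class_mem {C : ChainComplex (RMod (LaurentPolynomial R)) ℤ}
    (hC : IsStrictPerfect C) (hK : hC.K0Class ∈ (pStar R).range) : ExtendsToP1 C := by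
  obtain ⟨a, b, hab⟩ := hC.bounded
  refine extendsToP1_of_K0Class_mem_aux (b - a).toNat b hC (fun n hn => ?_) hK
  refine isExtended_of_isZero (hab n ?_)
  have := Int.self_le_toNat (b - a)
  omega

end Extension

end

theorem mainTheorem2 {R : Type u} [Ring R] (C : ChainComplex (RMod (LaurentPolynomial R)) ℤ)
    (hC : IsStrictPerfect C) :
    List.TFAE
      [ExtendsToP1 C,
        hC.K0Class ∈ (pStar R).range,
        hC.K0Class ∈ (iStar R).range] := by
  tfae_have 1 → 3 := ExtendsToP1.K0Class_mem hC
  tfae_have 3 → 2 := fun h => iStar_range_le h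
  tfae_have 2 → 1 := extendsToP1_of_K0Class_mem hC
  tfae_finish
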